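/- Let $(X,d)$ be a metric space which is geometrically doubling: there is $N\in\mathbb N$ such that every open ball $B(x,r)$, $r>0$, can be covered by at most $N$ open balls of radius $r/2$. Let $\mu$ be a Borel measure on $X$ which is upper doubling: there is a function $\lambda:X\times(0,\infty)\to(0,\infty)$ such that $r\mapsto\lambda(x,r)$ is non-decreasing for every $x\in X$, and there are constants $C_\lambda,C'_\lambda>0$ with $$\lambda(x,2r)\le C_\lambda\lambda(x,r),\qquad \mu(B(x,r))\le\lambda(x,r)\qquad\text{for all }x\in X,\ r>0,$$ $$\lambda(x,r)\le C'_\lambda\,\lambda(y,r)\qquad\text{for all } r>0,\ x,y\in X\text{ with } d(x,y)\le r .$$ Let functions be scalar valued (real or complex), and let $K\in L^1_{\rm loc}(X\times X\setminus\{(x,y):x=y\},\mu\times\mu)$ be a Calderón–Zygmund kernel: there are constants $C>0$, $0<c<1$ and $0<\delta\le1$ such that $$|K(x,y)|\le C\min\Big\{\frac1{\lambda(x,d(x,y))},\frac1{\lambda(y,d(x,y))}\Big\}\qquad\text{for all } x\ne y,$$ $$|K(x,y)-K(x',y)|+|K(y,x)-K(y,x')|\le C\,\frac{d(x,x')^\delta}{d(x,y)^\delta\,\lambda(x,d(x,y))}\qquad\text{whenever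 } x\ne y,\ d(x,x')\le c\,d(x,y).$$ Let $T$ be a Calderón–Zygmund operator with kernel $K$, that is, a linear operator, defined on $L^2(\mu)$ and with values in the ($\mu$-a.e. classes of) measurable functions, such that for every $f\in L^\infty(\mu)$ with bounded support $$Tf(x)=\int_X K(x,y)f(y)\,d\mu(y)\qquad\text{for }\mu\text{-a.e. }x\notin\operatorname{supp}f .$$ If $T$ is bounded on $L^2(\mu)$, i.e. $\|Tf\|_{L^2(\mu)}\le A\|f\|_{L^2(\mu)}$ for some constant $A$ and all $f\in L^2(\mu)$, then $T$ is of weak type $(1,1)$: there is a linear operator $T_1$ from $L^1(\mu)$ to the ($\mu$-a.e. classes of) measurable functions with $T_1f=Tf$ for all $f\in L^1(\mu)\cap L^2(\mu)$, and a constant $C_1>0$, such that $$\mu\{x\in X:|T_1f(x)|>t\}\le\frac{C_1}{t}\,\|f\|_{L^1(\mu)}\qquad\text{for all } f\in L^1(\mu),\ t>0 .$$ -/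

import Mathlib

open MeasureTheory

/-- `X` is geometrically doubling: for some `N`, every open ball of radius `r` is covered by at most
`N` open balls of radius `r / 2`. -/
def GeometricallyDoubling (X : Type*) [MetricSpace X] : Prop :=
  ∃ N : ℕ, ∀ (x : X) (r : ℝ), 0 < r →
    ∃ s : Finset X, s.card ≤ N ∧ Metric.ball x r ⊆ ⋃ y ∈ s, Metric.ball y (r / 2)

/-- `μ` is upper doubling with dominating function `lam : X × (0, ∞) → (0, ∞)`.
Only the values `lam x r` with `0 < r` matter. -/
structure IsUpperDoubling {X : Type*} [MetricSpace X] [MeasurableSpace X]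
    (μ : Measure X) (lam : X → ℝ → ℝ) : Prop where
  pos : ∀ x r, 0 < r → 0 < lam x r
  mono : ∀ x r s, 0 < r → r ≤ s → lam x r ≤ lam x s
  doubling : ∃ C : ℝ, 0 < C ∧ ∀ x r, 0 < r → lam x (2 * r) ≤ C * lam x r
  measure_ball_le : ∀ x r, 0 < r → μ (Metric.ball x r) ≤ ENNReal.ofReal (lam x r)
  comparable : ∃ C : ℝ, 0 < C ∧ ∀ x y r, 0 < r → dist x y ≤ r → lam x r ≤ C * lam y r

/-- Calderón–Zygmund kernels with respect to the dominating function `lam`. The values of `K` on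
the diagonal are irrelevant; the bound `c < 1` keeps `x' ≠ y` in the Hölder condition. -/
structure IsCalderonZygmundKernel {X 𝕜 : Type*} [MetricSpace X] [MeasurableSpace X] [RCLike 𝕜]
    (μ : Measure X) (lam : X → ℝ → ℝ) (K : X → X → 𝕜) : Prop where
  locallyIntegrable :
    LocallyIntegrableOn (fun p : X × X => K p.1 p.2) {p : X × X | p.1 ≠ p.2} (μ.prod μ)
  size : ∃ C : ℝ, 0 < C ∧ ∀ x y, x ≠ y →
    ‖K x y‖ ≤ C * min (1 / lam x (dist x y)) (1 / lam y (dist x y))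
  holder : ∃ δ : ℝ, 0 < δ ∧ δ ≤ 1 ∧ ∃ C : ℝ, 0 < C ∧ ∃ c : ℝ, 0 < c ∧ c < 1 ∧
    ∀ x x' y, x ≠ y → dist x x' ≤ c * dist x y →
      ‖K x y - K x' y‖ + ‖K y x - K y x'‖ ≤
        C * (dist x x' ^ δ / (dist x y ^ δ * lam x (dist x y)))

/-- When balls have finite measure, essentially bounded functions with bounded support are
square integrable, so that the hypothesis `h2` in `IsCalderonZygmundOperator` is automatic. -/
theorem IsUpperDoubling.memLp_two {X 𝕜 : Type*} [MetricSpace X] [MeasurableSpace X] [BorelSpace X]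
    [RCLike 𝕜] {μ : Measure X} {lam : X → ℝ → ℝ} (hμ : IsUpperDoubling μ lam) {f : X → 𝕜}
    (hf : MemLp f ⊤ μ) (hb : Bornology.IsBounded (Function.support f)) : MemLp f 2 μ := by
  rcases isEmpty_or_nonempty X with hX | ⟨⟨x⟩⟩
  · rw [Measure.eq_zero_of_isEmpty μ]
    simp
  · obtain ⟨r, hr0, hr⟩ := hb.subset_ball_lt 0 x
    exact hf.mono_exponent_of_measure_support_ne_top (s := Metric.ball x r)
      (fun y hy => by
        by_contra h
        exact hy (hr h))
      (ne_top_of_le_ne_top ENNReal.ofReal_ne_top (hμ.measure_ball_le x r hr0)) le_top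

/-- A linear operator `T`, defined on `L²(μ)` with values in the (a.e. classes of) measurable
functions, is a Calderón–Zygmund operator with kernel `K`: for every essentially bounded `f` with
bounded support, `T f x = ∫ K x y f y dμ(y)` for almost every `x` outside the (closed) support. -/
def IsCalderonZygmundOperator {X 𝕜 : Type*} [MetricSpace X] [MeasurableSpace X] [RCLike 𝕜]
    (μ : Measure X) (lam : X → ℝ → ℝ) (K : X → X → 𝕜)
    (T : Lp 𝕜 2 μ →ₗ[𝕜] (X →ₘ[μ] 𝕜)) : Prop :=
  IsCalderonZygmundKernel μ lam K ∧
    ∀ (f : X → 𝕜) (h2 : MemLp f 2 μ), MemLp f ⊤ μ → Bornology.IsBounded (Function.support f) →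
      ∀ᵐ x ∂μ, x ∉ tsupport f → T (h2.toLp f) x = ∫ y, K x y * f y ∂μ

/-- `T` is bounded on `L²(μ)`. -/
def IsBoundedOnL2 {X 𝕜 : Type*} [MeasurableSpace X] [RCLike 𝕜] {μ : Measure X}
    (T : Lp 𝕜 2 μ →ₗ[𝕜] (X →ₘ[μ] 𝕜)) : Prop :=
  ∃ A : ℝ, ∀ f : Lp 𝕜 2 μ, eLpNorm (T f) 2 μ ≤ ENNReal.ofReal (A * ‖f‖)

/-- `T` is of weak type `(1,1)`: it extends to a linear operator `T₁` on `L¹(μ)`, agreeing with `T`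
on `L¹(μ) ∩ L²(μ)`, with `μ {|T₁ f| > t} ≤ (C / t) ‖f‖₁` for all `f ∈ L¹(μ)` and `t > 0`. -/
def IsWeakTypeOneOne {X 𝕜 : Type*} [MeasurableSpace X] [RCLike 𝕜] {μ : Measure X}
    (T : Lp 𝕜 2 μ →ₗ[𝕜] (X →ₘ[μ] 𝕜)) : Prop :=
  ∃ T₁ : Lp 𝕜 1 μ →ₗ[𝕜] (X →ₘ[μ] 𝕜),
    (∀ (f : Lp 𝕜 1 μ) (g : Lp 𝕜 2 μ), (f : X →ₘ[μ] 𝕜) = (g : X →ₘ[μ] 𝕜) → T₁ f = T g) ∧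
    ∃ C : ℝ, 0 < C ∧ ∀ (f : Lp 𝕜 1 μ) (t : ℝ), 0 < t →
      μ {x | t < ‖T₁ f x‖} ≤ ENNReal.ofReal (C / t * ‖f‖)

open Set Filter Topology Metric
open scoped ENNReal NNReal

section Space

variable {X : Type*} [MetricSpace X]

theorem GeometricallyDoubling.exists_finset_cover (hX : GeometricallyDoubling X) (k : ℕ) (x : X)
    {r : ℝ} (hr : 0 < r) :
    ∃ s : Finset X, ball x r ⊆ ⋃ y ∈ s, ball y (r / 2 ^ k) := by
  classical
  induction k with
  | zero => exact ⟨{x}, by simp⟩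
  | succ k ih =>
    obtain ⟨s, hs⟩ := ih
    obtain ⟨N, hN⟩ := hX
    choose F _ hF using fun y => hN y (r / 2 ^ k) (by positivity)
    refine ⟨s.biUnion F, fun z hz => ?_⟩
    obtain ⟨y, hy, hzy⟩ := mem_iUnion₂.1 (hs hz)
    obtain ⟨w, hw, hzw⟩ := mem_iUnion₂.1 (hF y hzy)
    refine mem_iUnion₂.2 ⟨w, Finset.mem_biUnion.2 ⟨y, hy, hw⟩, ?_⟩
    rwa [pow_succ, ← div_div]

theorem GeometricallyDoubling.secondCountableTopology (hX : GeometricallyDoubling X) :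
    SecondCountableTopology X := by
  rcases isEmpty_or_nonempty X with h | ⟨⟨x⟩⟩
  · infer_instance
  refine Metric.secondCountable_of_almost_dense_set fun ε hε => ?_
  have key : ∀ n : ℕ, ∃ s : Finset X, ball x (n + 1) ⊆ ⋃ y ∈ s, ball y ε := by
    intro n
    obtain ⟨k, hk⟩ := pow_unbounded_of_one_lt ((n + 1 : ℝ) / ε) (one_lt_two)
    obtain ⟨s, hs⟩ := hX.exists_finset_cover k x (r := n + 1) (by positivity)
    refine ⟨s, hs.trans (iUnion₂_mono fun y _ => ball_subset_ball ?_)⟩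
    rw [div_le_iff₀ (by positivity)]
    rw [div_lt_iff₀ hε] at hk
    linarith
  choose s hs using key
  refine ⟨⋃ n, (s n : Set X), countable_iUnion fun n => (s n).countable_toSet, fun z => ?_⟩
  obtain ⟨n, hn⟩ := exists_nat_gt (dist z x)
  obtain ⟨y, hy, hzy⟩ := mem_iUnion₂.1 (hs n (mem_ball.2 (by linarith) : z ∈ ball x (n + 1)))
  exact ⟨y, mem_iUnion.2 ⟨n, hy⟩, (mem_ball.1 hzy).le⟩

variable [MeasurableSpace X]

theorem IsUpperDoubling.measure_ball_lt_top {μ : Measure X} {lam : X → ℝ → ℝ}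
    (hμ : IsUpperDoubling μ lam) (x : X) (r : ℝ) : μ (ball x r) < ∞ := by
  rcases le_or_gt r 0 with hr | hr
  · simp [ball_eq_empty.2 hr]
  · exact (hμ.measure_ball_le x r hr).trans_lt ENNReal.ofReal_lt_top

theorem IsUpperDoubling.isLocallyFiniteMeasure {μ : Measure X} {lam : X → ℝ → ℝ}
    (hμ : IsUpperDoubling μ lam) : IsLocallyFiniteMeasure μ :=
  ⟨fun x => ⟨ball x 1, ball_mem_nhds x one_pos, hμ.measure_ball_lt_top x 1⟩⟩

/-- The superlevel set of a non-centred maximal function whose averages are normalised by the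
measure of enlarged balls. -/
def maximalSet (μ : Measure X) (u : X → ℝ≥0∞) (t : ℝ≥0∞) : Set X :=
  ⋃ p ∈ {p : X × ℝ | 0 < p.2 ∧ t * μ (ball p.1 (6 * p.2)) < ∫⁻ y in ball p.1 p.2, u y ∂μ},
    ball p.1 p.2

theorem isOpen_maximalSet (μ : Measure X) (u : X → ℝ≥0∞) (t : ℝ≥0∞) :
    IsOpen (maximalSet μ u t) :=
  isOpen_biUnion fun _ _ => isOpen_ball

theorem setLIntegral_ball_le_of_notMem_maximalSet {μ : Measure X} {u : X → ℝ≥0∞} {t : ℝ≥0∞} {z : X}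
    (hz : z ∉ maximalSet μ u t) (r : ℝ) :
    ∫⁻ y in ball z r, u y ∂μ ≤ t * μ (ball z (6 * r)) := by
  rcases le_or_gt r 0 with hr | hr
  · simp [ball_eq_empty.2 hr]
  · by_contra! h
    exact hz (mem_iUnion₂.2 ⟨(z, r), ⟨hr, h⟩, mem_ball_self hr⟩)

theorem mul_measure_maximalSet_le [BorelSpace X] [SecondCountableTopology X] (μ : Measure X)
    (u : X → ℝ≥0∞) (t : ℝ≥0∞) : t * μ (maximalSet μ u t) ≤ ∫⁻ y, u y ∂μ := by
  set I : ℕ → Set (X × ℝ) := fun n => {p | p.2 ≤ n ∧ 0 < p.2 ∧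
    t * μ (ball p.1 (6 * p.2)) < ∫⁻ y in ball p.1 p.2, u y ∂μ} with hI
  have hU : maximalSet μ u t = ⋃ n, ⋃ p ∈ I n, ball p.1 p.2 := by
    ext x
    simp only [maximalSet, mem_iUnion, hI, mem_ofPred_eq, exists_prop]
    constructor
    · rintro ⟨p, hp, hx⟩
      obtain ⟨n, hn⟩ := exists_nat_ge p.2
      exact ⟨n, p, ⟨hn, hp⟩, hx⟩
    · rintro ⟨n, p, ⟨_, hp⟩, hx⟩
      exact ⟨p, hp, hx⟩
  have hmono : Monotone fun n => ⋃ p ∈ I n, ball p.1 p.2 := fun m n hmn =>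
    biUnion_subset_biUnion_left fun p hp => ⟨hp.1.trans (by exact_mod_cast hmn), hp.2⟩
  rw [hU, hmono.measure_iUnion, ENNReal.mul_iSup]
  refine iSup_le fun n => ?_
  obtain ⟨J, hJI, hJd, hJ⟩ := Vitali.exists_disjoint_subfamily_covering_enlargement_closedBall
    (I n) (fun p => p.1) (fun p => p.2) n (fun p hp => hp.1) 5 (by norm_num)
  have hd : J.PairwiseDisjoint fun p => ball p.1 p.2 :=
    hJd.mono fun p => ball_subset_closedBall
  have hc : J.Countable := hd.countable_of_isOpen (fun p _ => isOpen_ball)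
    (fun p hp => ⟨p.1, mem_ball_self (hJI hp).2.1⟩)
  calc t * μ (⋃ p ∈ I n, ball p.1 p.2)
      ≤ t * μ (⋃ p ∈ J, ball p.1 (6 * p.2)) := by
        refine mul_le_mul' le_rfl (measure_mono fun x hx => ?_)
        obtain ⟨p, hp, hxp⟩ := mem_iUnion₂.1 hx
        obtain ⟨q, hq, hpq⟩ := hJ p hp
        have := (hJI hq).2.1
        exact mem_iUnion₂.2 ⟨q, hq, closedBall_subset_ball (by linarith)
          (hpq (ball_subset_closedBall hxp))⟩
    _ ≤ t * ∑' p : J, μ (ball p.1.1 (6 * p.1.2)) := by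
        gcongr
        exact measure_biUnion_le μ hc _
    _ = ∑' p : J, t * μ (ball p.1.1 (6 * p.1.2)) := ENNReal.tsum_mul_left.symm
    _ ≤ ∑' p : J, ∫⁻ y in ball p.1.1 p.1.2, u y ∂μ :=
        ENNReal.tsum_le_tsum fun p => (hJI p.2).2.2.le
    _ = ∫⁻ y in ⋃ p ∈ J, ball p.1 p.2, u y ∂μ :=
        (lintegral_biUnion hc (fun _ _ => measurableSet_ball) hd _).symm
    _ ≤ ∫⁻ y, u y ∂μ := setLIntegral_le_lintegral _ _

end Space

section Annuli

set_option linter.unusedSectionVars false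

variable {X : Type*} [MetricSpace X] [MeasurableSpace X]

theorem IsUpperDoubling.exists_dilation {μ : Measure X} {lam : X → ℝ → ℝ}
    (hμ : IsUpperDoubling μ lam) (M : ℝ) :
    ∃ Λ D : ℝ, 1 < Λ ∧ M ≤ Λ ∧ 1 ≤ D ∧ ∀ x r, 0 < r → lam x (Λ * r) ≤ D * lam x r := by
  obtain ⟨C, -, hC⟩ := hμ.doubling
  obtain ⟨m, hm⟩ := pow_unbounded_of_one_lt (max M 1) one_lt_two
  refine ⟨2 ^ m, max C 1 ^ m, (le_max_right _ _).trans_lt hm, (le_max_left _ _).trans hm.le,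
    one_le_pow₀ (le_max_right _ _), ?_⟩
  clear hm
  induction m with
  | zero => intro x r _; simp
  | succ m ih =>
    intro x r hr
    calc lam x (2 ^ (m + 1) * r) = lam x (2 * (2 ^ m * r)) := by ring_nf
      _ ≤ C * lam x (2 ^ m * r) := hC x _ (by positivity)
      _ ≤ max C 1 * lam x (2 ^ m * r) := by
          have := hμ.pos x (2 ^ m * r) (by positivity)
          gcongr
          exact le_max_left _ _
      _ ≤ max C 1 * (max C 1 ^ m * lam x r) := by
          have := ih x r hr
          gcongr
      _ = max C 1 ^ (m + 1) * lam x r := by ring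

variable {μ : Measure X} {lam : X → ℝ → ℝ} {Λ D : ℝ}

theorem IsUpperDoubling.lam_pow_mul_le (hD : 1 ≤ D) (hΛ : 1 < Λ)
    (hlam : ∀ x r, 0 < r → lam x (Λ * r) ≤ D * lam x r) (x : X) {r : ℝ} (hr : 0 < r) (k : ℕ) :
    lam x (Λ ^ k * r) ≤ D ^ k * lam x r := by
  induction k with
  | zero => simp
  | succ k ih =>
    calc lam x (Λ ^ (k + 1) * r) = lam x (Λ * (Λ ^ k * r)) := by ring_nf
      _ ≤ D * lam x (Λ ^ k * r) := hlam x _ (by positivity)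
      _ ≤ D * (D ^ k * lam x r) := by gcongr
      _ = D ^ (k + 1) * lam x r := by ring

theorem IsUpperDoubling.measureReal_ball_le (hμ : IsUpperDoubling μ lam) (x : X) {r : ℝ}
    (hr : 0 < r) : μ.real (ball x r) ≤ lam x r :=
  ENNReal.toReal_le_of_le_ofReal (hμ.pos x r hr).le (hμ.measure_ball_le x r hr)

/-- `Λ ^ k * r` is the smallest doubling radius at `x` of the form `Λ ^ j * r`. -/
def IsFirstDoublingExponent (μ : Measure X) (Λ D : ℝ) (x : X) (r : ℝ) (k : ℕ) : Prop :=
  μ.real (ball x (Λ ^ (k + 1) * r)) ≤ 2 * D * μ.real (ball x (Λ ^ k * r)) ∧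
    ∀ j < k, 2 * D * μ.real (ball x (Λ ^ j * r)) ≤ μ.real (ball x (Λ ^ (j + 1) * r))

theorem IsUpperDoubling.exists_isFirstDoublingExponent (hμ : IsUpperDoubling μ lam) (hD : 1 ≤ D)
    (hΛ : 1 < Λ) (hlam : ∀ x r, 0 < r → lam x (Λ * r) ≤ D * lam x r) {x : X} {r : ℝ} (hr : 0 < r)
    (hx : 0 < μ.real (ball x r)) : ∃ k, IsFirstDoublingExponent μ Λ D x r k := by
  classical
  have ex : ∃ k, μ.real (ball x (Λ ^ (k + 1) * r)) ≤ 2 * D * μ.real (ball x (Λ ^ k * r)) := by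
    by_contra! h
    have h1 : ∀ k, (2 * D) ^ k * μ.real (ball x r) ≤ μ.real (ball x (Λ ^ k * r)) := by
      intro k
      induction k with
      | zero => simp
      | succ k ih =>
        calc (2 * D) ^ (k + 1) * μ.real (ball x r)
            = 2 * D * ((2 * D) ^ k * μ.real (ball x r)) := by ring
          _ ≤ 2 * D * μ.real (ball x (Λ ^ k * r)) := by gcongr
          _ ≤ _ := (h k).le
    obtain ⟨k, hk⟩ := pow_unbounded_of_one_lt (lam x r / μ.real (ball x r)) one_lt_two
    rw [div_lt_iff₀ hx] at hk
    have h2 : D ^ k * (2 ^ k * μ.real (ball x r)) ≤ D ^ k * lam x r :=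
      calc D ^ k * (2 ^ k * μ.real (ball x r)) = (2 * D) ^ k * μ.real (ball x r) := by
            rw [mul_pow]; ring
        _ ≤ μ.real (ball x (Λ ^ k * r)) := h1 k
        _ ≤ lam x (Λ ^ k * r) := hμ.measureReal_ball_le x (by positivity)
        _ ≤ D ^ k * lam x r := IsUpperDoubling.lam_pow_mul_le hD hΛ hlam x hr k
    exact absurd (le_of_mul_le_mul_left h2 (by positivity)) (not_le.2 hk)
  exact ⟨Nat.find ex, Nat.find_spec ex, fun j hj => (not_le.1 (Nat.find_min ex hj)).le⟩

theorem IsFirstDoublingExponent.two_pow_mul_measureReal_le {k : ℕ} {x : X} {r : ℝ}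
    (h : IsFirstDoublingExponent μ Λ D x r k) (hμ : IsUpperDoubling μ lam) (hD : 1 ≤ D)
    (hΛ : 1 < Λ) (hlam : ∀ x r, 0 < r → lam x (Λ * r) ≤ D * lam x r) (hr : 0 < r)
    (i j : ℕ) (hij : j + i = k) :
    2 ^ i * μ.real (ball x (Λ ^ (j + 1) * r)) ≤ 2 * D * lam x (Λ ^ j * r) := by
  have h0 : ∀ i j, j + i = k → (2 * D) ^ i * μ.real (ball x (Λ ^ j * r)) ≤
      μ.real (ball x (Λ ^ k * r)) := by
    intro i
    induction i with
    | zero =>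
      rintro j rfl
      simp
    | succ i ih =>
      intro j hj
      calc (2 * D) ^ (i + 1) * μ.real (ball x (Λ ^ j * r))
          = (2 * D) ^ i * (2 * D * μ.real (ball x (Λ ^ j * r))) := by ring
        _ ≤ (2 * D) ^ i * μ.real (ball x (Λ ^ (j + 1) * r)) := by
            gcongr
            exact h.2 j (by omega)
        _ ≤ _ := ih (j + 1) (by omega)
  have h1 : (2 * D) ^ i * μ.real (ball x (Λ ^ (j + 1) * r)) ≤
      2 * D * μ.real (ball x (Λ ^ k * r)) := by
    cases i with
    | zero =>
      subst hij
      simpa using h.1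
    | succ i =>
      rw [pow_succ', mul_assoc]
      gcongr
      exact h0 i (j + 1) (by omega)
  have h2 : lam x (Λ ^ k * r) ≤ D ^ i * lam x (Λ ^ j * r) := by
    have := IsUpperDoubling.lam_pow_mul_le hD hΛ hlam x (r := Λ ^ j * r) (by positivity) i
    rwa [← mul_assoc, ← pow_add, add_comm, hij] at this
  have h3 := hμ.measureReal_ball_le x (r := Λ ^ k * r) (by positivity)
  have h4 : D ^ i * (2 ^ i * μ.real (ball x (Λ ^ (j + 1) * r))) ≤
      D ^ i * (2 * D * lam x (Λ ^ j * r)) :=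
    calc D ^ i * (2 ^ i * μ.real (ball x (Λ ^ (j + 1) * r)))
        = (2 * D) ^ i * μ.real (ball x (Λ ^ (j + 1) * r)) := by rw [mul_pow]; ring
      _ ≤ 2 * D * μ.real (ball x (Λ ^ k * r)) := h1
      _ ≤ 2 * D * (D ^ i * lam x (Λ ^ j * r)) := by
          gcongr
          exact h3.trans h2
      _ = _ := by ring
  exact le_of_mul_le_mul_left h4 (by positivity)

variable [BorelSpace X]

theorem IsUpperDoubling.setLIntegral_annulus_le (hμ : IsUpperDoubling μ lam) {x : X} {r s : ℝ}
    (hr : 0 < r) {V : Set X} (hV : MeasurableSet V) (hVs : V ⊆ ball x s \ ball x r)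
    {G : X → ℝ≥0∞} {M : ℝ≥0∞}
    (hG : ∀ᵐ y ∂μ, y ∈ V → G y ≤ M * ENNReal.ofReal (1 / lam x (dist y x))) :
    ∫⁻ y in V, G y ∂μ ≤ M * ENNReal.ofReal (μ.real (ball x s) / lam x r) := by
  have hl := hμ.pos x r hr
  calc ∫⁻ y in V, G y ∂μ ≤ ∫⁻ _ in V, M * ENNReal.ofReal (1 / lam x r) ∂μ := by
        refine setLIntegral_mono_ae' hV ?_
        filter_upwards [hG] with y hy hyV
        have hry : r ≤ dist y x := not_lt.1 (hVs hyV).2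
        refine (hy hyV).trans ?_
        gcongr
        exact hμ.mono x r _ hr hry
    _ = M * ENNReal.ofReal (1 / lam x r) * μ V := setLIntegral_const _ _
    _ ≤ M * ENNReal.ofReal (1 / lam x r) * ENNReal.ofReal (μ.real (ball x s)) := by
        gcongr
        rw [measureReal_def, ENNReal.ofReal_toReal (hμ.measure_ball_lt_top x s).ne]
        exact measure_mono (hVs.trans sdiff_subset)
    _ = _ := by
        rw [mul_assoc, ← ENNReal.ofReal_mul (by positivity)]
        congr 2
        ring

theorem exists_pow_mul_le_dist_lt (hΛ : 1 < Λ) {x y : X} {r : ℝ} (hr : 0 < r) (h : r ≤ dist y x) :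
    ∃ j : ℕ, y ∈ ball x (Λ ^ (j + 1) * r) \ ball x (Λ ^ j * r) := by
  obtain ⟨j, h1, h2⟩ := exists_nat_pow_near ((one_le_div hr).2 h) hΛ
  rw [le_div_iff₀ hr] at h1
  rw [div_lt_iff₀ hr] at h2
  exact ⟨j, mem_ball.2 h2, fun h => absurd (mem_ball.1 h) (not_lt.2 h1)⟩

theorem IsFirstDoublingExponent.setLIntegral_le {k : ℕ} {x : X} {r : ℝ}
    (h : IsFirstDoublingExponent μ Λ D x r k) (hμ : IsUpperDoubling μ lam) (hD : 1 ≤ D)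
    (hΛ : 1 < Λ) (hlam : ∀ x r, 0 < r → lam x (Λ * r) ≤ D * lam x r) (hr : 0 < r)
    {V : Set X} (hV : MeasurableSet V) (hVs : V ⊆ ball x (Λ ^ (k + 1) * r) \ ball x r)
    {G : X → ℝ≥0∞} {M : ℝ≥0∞}
    (hG : ∀ᵐ y ∂μ, y ∈ V → G y ≤ M * ENNReal.ofReal (1 / lam x (dist y x))) :
    ∫⁻ y in V, G y ∂μ ≤ M * ENNReal.ofReal (4 * D) := by
  set A : ℕ → Set X := fun j => V ∩ (ball x (Λ ^ (j + 1) * r) \ ball x (Λ ^ j * r)) with hA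
  have hAm : ∀ j, MeasurableSet (A j) := fun j =>
    hV.inter (measurableSet_ball.diff measurableSet_ball)
  have hsub : V ⊆ ⋃ j : Fin (k + 1), A j := by
    intro y hy
    obtain ⟨j, hj⟩ := exists_pow_mul_le_dist_lt hΛ hr (not_lt.1 (hVs hy).2 : r ≤ dist y x)
    refine mem_iUnion.2 ⟨⟨j, ?_⟩, hy, hj⟩
    by_contra! hkj
    refine hj.2 (ball_subset_ball ?_ (hVs hy).1)
    gcongr
    exact hΛ.le
  have hterm : ∀ j ∈ Finset.range (k + 1), ∫⁻ y in A j, G y ∂μ ≤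
      M * ENNReal.ofReal (2 * D * (1 / 2) ^ (k - j)) := by
    intro j hj
    have hj' : j + (k - j) = k := by
      have := Finset.mem_range.1 hj
      omega
    refine (hμ.setLIntegral_annulus_le (by positivity) (hAm j) inter_subset_right
      (hG.mono fun y hy hyA => hy hyA.1)).trans ?_
    gcongr
    have h1 := h.two_pow_mul_measureReal_le hμ hD hΛ hlam hr _ _ hj'
    rw [div_le_iff₀ (hμ.pos x _ (by positivity)), one_div, inv_pow, mul_right_comm,
      ← div_eq_mul_inv, le_div_iff₀ (by positivity)]
    linarith
  calc ∫⁻ y in V, G y ∂μ ≤ ∫⁻ y in ⋃ j : Fin (k + 1), A j, G y ∂μ :=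
        lintegral_mono_set hsub
    _ ≤ ∑' j : Fin (k + 1), ∫⁻ y in A j, G y ∂μ := lintegral_iUnion_le _ _
    _ = ∑ j ∈ Finset.range (k + 1), ∫⁻ y in A j, G y ∂μ := by
        rw [tsum_fintype, Fin.sum_univ_eq_sum_range fun j => ∫⁻ y in A j, G y ∂μ]
    _ ≤ ∑ j ∈ Finset.range (k + 1), M * ENNReal.ofReal (2 * D * (1 / 2) ^ (k - j)) :=
        Finset.sum_le_sum hterm
    _ = M * ENNReal.ofReal (2 * D * ∑ j ∈ Finset.range (k + 1), (1 / 2) ^ (k - j)) := by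
        rw [← Finset.mul_sum, Finset.mul_sum _ _ (2 * D),
          ENNReal.ofReal_sum_of_nonneg fun j _ => by positivity]
    _ ≤ M * ENNReal.ofReal (2 * D * 2) := by
        gcongr
        have := Finset.sum_range_reflect (fun j => (1 / 2 : ℝ) ^ j) (k + 1)
        simp only [Nat.add_sub_cancel] at this
        rw [this]
        exact sum_geometric_two_le _
    _ = _ := by ring_nf

theorem IsUpperDoubling.setLIntegral_compl_ball_le (hμ : IsUpperDoubling μ lam) (hD : 1 ≤ D)
    (hΛ : 1 < Λ) (hlam : ∀ x r, 0 < r → lam x (Λ * r) ≤ D * lam x r) {δ : ℝ} (hδ : 0 < δ)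
    {x : X} {r : ℝ} (hr : 0 < r) {V : Set X} (hV : MeasurableSet V) (hVs : V ⊆ (ball x r)ᶜ)
    {G : X → ℝ≥0∞} {M : ℝ≥0∞}
    (hG : ∀ᵐ y ∂μ, y ∈ V → G y ≤
      M * ENNReal.ofReal (r ^ δ / (dist y x ^ δ * lam x (dist y x)))) :
    ∫⁻ y in V, G y ∂μ ≤ M * ENNReal.ofReal (D / (1 - (Λ ^ δ)⁻¹)) := by
  set A : ℕ → Set X := fun j => V ∩ (ball x (Λ ^ (j + 1) * r) \ ball x (Λ ^ j * r)) with hA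
  have hAm : ∀ j, MeasurableSet (A j) := fun j =>
    hV.inter (measurableSet_ball.diff measurableSet_ball)
  have hsub : V ⊆ ⋃ j, A j := by
    intro y hy
    obtain ⟨j, hj⟩ := exists_pow_mul_le_dist_lt hΛ hr (not_lt.1 (hVs hy) : r ≤ dist y x)
    exact mem_iUnion.2 ⟨j, hy, hj⟩
  have hΛδ : 1 < Λ ^ δ := Real.one_lt_rpow hΛ hδ
  have hq : (Λ ^ δ)⁻¹ < 1 := inv_lt_one_of_one_lt₀ hΛδ
  have hq0 : 0 ≤ (Λ ^ δ)⁻¹ := by positivity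
  have hterm : ∀ j, ∫⁻ y in A j, G y ∂μ ≤ M * ENNReal.ofReal (D * (Λ ^ δ)⁻¹ ^ j) := by
    intro j
    have hj0 : 0 < Λ ^ j * r := by positivity
    have := hμ.setLIntegral_annulus_le (G := G) (M := M * ENNReal.ofReal ((Λ ^ δ)⁻¹ ^ j)) hj0
      (hAm j) inter_subset_right (by
        filter_upwards [hG] with y hy hyA
        refine (hy hyA.1).trans ?_
        have h1 : Λ ^ j * r ≤ dist y x := not_lt.1 hyA.2.2
        have h0 : 0 < dist y x := hj0.trans_le h1
        have h2 := hμ.pos x _ h0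
        rw [mul_assoc, ← ENNReal.ofReal_mul (by positivity)]
        gcongr
        rw [div_mul_eq_div_div, div_eq_mul_one_div _ (lam x (dist y x))]
        refine mul_le_mul_of_nonneg_right ?_ (by positivity)
        rw [← Real.div_rpow hr.le h0.le, ← Real.inv_rpow (by positivity), ← Real.rpow_natCast,
          ← Real.rpow_mul (by positivity), mul_comm δ, Real.rpow_mul (by positivity),
          Real.rpow_natCast]
        refine Real.rpow_le_rpow (by positivity) ?_ hδ.le
        rw [div_le_iff₀ h0, inv_pow, inv_mul_eq_div, le_div_iff₀ (by positivity)]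
        linarith)
    refine this.trans ?_
    rw [mul_assoc, ← ENNReal.ofReal_mul (by positivity)]
    refine mul_le_mul' le_rfl (ENNReal.ofReal_le_ofReal ?_)
    rw [mul_comm D]
    refine mul_le_mul_of_nonneg_left ?_ (by positivity)
    rw [div_le_iff₀ (hμ.pos x _ hj0)]
    refine (hμ.measureReal_ball_le x (by positivity)).trans ?_
    have := hlam x _ hj0
    rwa [← mul_assoc, ← pow_succ'] at this
  calc ∫⁻ y in V, G y ∂μ ≤ ∫⁻ y in ⋃ j, A j, G y ∂μ := lintegral_mono_set hsub
    _ ≤ ∑' j, ∫⁻ y in A j, G y ∂μ := lintegral_iUnion_le _ _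
    _ ≤ ∑' j, M * ENNReal.ofReal (D * (Λ ^ δ)⁻¹ ^ j) := ENNReal.tsum_le_tsum hterm
    _ = M * ENNReal.ofReal (D / (1 - (Λ ^ δ)⁻¹)) := by
        rw [ENNReal.tsum_mul_left, ← ENNReal.ofReal_tsum_of_nonneg (fun j => by positivity)
          ((summable_geometric_of_lt_one hq0 hq).mul_left D), tsum_mul_left,
          tsum_geometric_of_lt_one hq0 hq, div_eq_mul_inv]

end Annuli

section Kernel

variable {X 𝕜 : Type*} [MetricSpace X] [MeasurableSpace X] [RCLike 𝕜]
  {μ : Measure X} {lam : X → ℝ → ℝ} {K : X → X → 𝕜}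

theorem IsCalderonZygmundKernel.exists_far_bound (hK : IsCalderonZygmundKernel μ lam K)
    (hμ : IsUpperDoubling μ lam) :
    ∃ C δ Λ₀ : ℝ, 0 ≤ C ∧ 0 < δ ∧ ∀ Λ, 1 < Λ → Λ₀ ≤ Λ → ∀ (x z : X) (r : ℝ) (h : X → 𝕜), 0 < r →
      Function.support h ⊆ ball z r → Integrable h μ → ∫ y, h y ∂μ = 0 → Λ * r ≤ dist x z →
      ‖∫ y, K x y * h y ∂μ‖ₑ ≤ ENNReal.ofReal C * (∫⁻ y, ‖h y‖ₑ ∂μ) *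
        ENNReal.ofReal (r ^ δ / (dist x z ^ δ * lam z (dist x z))) := by
  obtain ⟨δ, hδ, -, C, hC, c, hc, -, hH⟩ := hK.holder
  refine ⟨C, δ, 1 / c, hC.le, hδ, fun Λ hΛ hcΛ x z r h hr hsupp hint hzero hxz => ?_⟩
  by_cases hKh : Integrable (fun y => K x y * h y) μ
  swap
  · rw [integral_undef hKh]
    simp
  have hd : 0 < dist x z := lt_of_lt_of_le (by positivity) hxz
  have hl := hμ.pos z _ hd
  have e : ∫ y, K x y * h y ∂μ = ∫ y, (K x y - K x z) * h y ∂μ := by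
    simp_rw [sub_mul]
    rw [integral_sub hKh (hint.const_mul _), integral_const_mul, hzero, mul_zero, sub_zero]
  rw [e]
  refine (enorm_integral_le_lintegral_enorm _).trans ?_
  rw [mul_right_comm, ← ENNReal.ofReal_mul hC.le, ← lintegral_const_mul' _ _ ENNReal.ofReal_ne_top]
  refine lintegral_mono fun y => ?_
  by_cases hy : h y = 0
  · simp [hy]
  have hyz : dist y z < r := hsupp hy
  rw [enorm_mul]
  gcongr
  rw [← ofReal_norm]
  refine ENNReal.ofReal_le_ofReal ?_
  have h1 := hH z y x (dist_pos.1 (dist_comm x z ▸ hd)) (by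
    rw [dist_comm z y, dist_comm z x]
    rw [one_div, inv_le_iff_one_le_mul₀ hc] at hcΛ
    calc dist y z ≤ r := hyz.le
      _ ≤ (c * Λ) * r := le_mul_of_one_le_left hr.le (by linarith)
      _ = c * (Λ * r) := by ring
      _ ≤ c * dist x z := by gcongr)
  have h2 : ‖K x y - K x z‖ ≤
      C * (dist z y ^ δ / (dist z x ^ δ * lam z (dist z x))) := by
    rw [norm_sub_rev]
    exact (le_add_of_nonneg_left (norm_nonneg _)).trans h1
  refine h2.trans ?_
  rw [dist_comm z x, dist_comm z y]
  gcongr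

theorem IsCalderonZygmundKernel.exists_near_bound (hK : IsCalderonZygmundKernel μ lam K)
    (hμ : IsUpperDoubling μ lam) :
    ∃ C : ℝ, 0 ≤ C ∧ ∀ (x z : X) (r : ℝ) (b : X → 𝕜), 0 < r →
      Function.support b ⊆ ball z r → 2 * r ≤ dist x z →
      ‖∫ y, K x y * b y ∂μ‖ₑ ≤ ENNReal.ofReal C * (∫⁻ y, ‖b y‖ₑ ∂μ) *
        ENNReal.ofReal (1 / lam z (dist x z)) := by
  obtain ⟨C, hC, hS⟩ := hK.size
  obtain ⟨C₁, hC₁, hdbl⟩ := hμ.doubling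
  obtain ⟨C₂, hC₂, hcmp⟩ := hμ.comparable
  refine ⟨C * (C₁ * C₂), by positivity, fun x z r b hr hsupp hxz => ?_⟩
  refine (enorm_integral_le_lintegral_enorm _).trans ?_
  rw [mul_right_comm, ← ENNReal.ofReal_mul (by positivity),
    ← lintegral_const_mul' _ _ ENNReal.ofReal_ne_top]
  refine lintegral_mono fun y => ?_
  by_cases hy : b y = 0
  · simp [hy]
  have hyz : dist y z < r := hsupp hy
  have htri := dist_triangle x y z
  have hxy : 0 < dist x y := by linarith
  have hxz0 : 0 < dist x z := by linarith
  rw [enorm_mul]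
  gcongr
  rw [← ofReal_norm]
  refine ENNReal.ofReal_le_ofReal ?_
  have h1 : lam z (dist x z) ≤ C₁ * C₂ * lam y (dist x y) :=
    calc lam z (dist x z) ≤ lam z (2 * dist x y) := hμ.mono _ _ _ hxz0 (by linarith)
      _ ≤ C₁ * lam z (dist x y) := hdbl _ _ hxy
      _ ≤ C₁ * (C₂ * lam y (dist x y)) := by
          gcongr
          exact hcmp _ _ _ hxy (by rw [dist_comm]; linarith)
      _ = _ := by ring
  have h2 := hμ.pos y _ hxy
  have h3 := hμ.pos z _ hxz0
  calc ‖K x y‖ ≤ C * min (1 / lam x (dist x y)) (1 / lam y (dist x y)) :=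
        hS x y (dist_pos.1 hxy)
    _ ≤ C * (1 / lam y (dist x y)) := by
        gcongr
        exact min_le_right _ _
    _ ≤ C * (C₁ * C₂ * (1 / lam z (dist x z))) := by
        gcongr
        rw [mul_one_div, div_le_div_iff₀ h2 h3]
        linarith
    _ = _ := by ring

end Kernel

section Balancer

variable {X 𝕜 : Type*} [MeasurableSpace X] [RCLike 𝕜]

/-- The multiple of the indicator function of `S` that has the same integral as `b`. -/
noncomputable def balancer (μ : Measure X) (b : X → 𝕜) (S : Set X) : X → 𝕜 :=
  S.indicator fun _ => (∫ y, b y ∂μ) / (μ.real S : 𝕜)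

variable {μ : Measure X} {b : X → 𝕜} {S : Set X}

theorem support_balancer_subset : Function.support (balancer μ b S) ⊆ S :=
  support_indicator_subset

theorem enorm_mul_measure_le (h0 : 0 < μ.real S) :
    ‖(∫ y, b y ∂μ) / (μ.real S : 𝕜)‖ₑ * μ S ≤ ∫⁻ y, ‖b y‖ₑ ∂μ := by
  have hS : μ S ≠ ∞ := fun h => by simp [measureReal_def, h] at h0
  have e : μ S = ‖(μ.real S : 𝕜)‖ₑ := by
    rw [← ofReal_norm, RCLike.norm_ofReal, abs_of_pos h0, measureReal_def,
      ENNReal.ofReal_toReal hS]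
  have hne : (μ.real S : 𝕜) ≠ 0 := by exact_mod_cast h0.ne'
  rw [e, ← enorm_mul, div_mul_cancel₀ _ hne]
  exact enorm_integral_le_lintegral_enorm _

theorem memLp_balancer (p : ℝ≥0∞) (hSm : MeasurableSet S) (hS : μ S ≠ ∞) :
    MemLp (balancer μ b S) p μ :=
  memLp_indicator_const p hSm _ (Or.inr hS)

theorem lintegral_enorm_balancer_le (hSm : MeasurableSet S) (h0 : 0 < μ.real S) :
    ∫⁻ y, ‖balancer μ b S y‖ₑ ∂μ ≤ ∫⁻ y, ‖b y‖ₑ ∂μ := by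
  simp_rw [balancer, enorm_indicator_eq_indicator_enorm]
  rw [lintegral_indicator_const hSm]
  exact enorm_mul_measure_le h0

theorem integral_balancer (hSm : MeasurableSet S) (h0 : 0 < μ.real S) :
    ∫ y, balancer μ b S y ∂μ = ∫ y, b y ∂μ := by
  have hne : (μ.real S : 𝕜) ≠ 0 := by exact_mod_cast h0.ne'
  rw [balancer, integral_indicator_const _ hSm, RCLike.real_smul_eq_coe_mul, mul_div_cancel₀ _ hne]

end Balancer

section Balanced

set_option linter.unusedSectionVars false

variable {X 𝕜 : Type*} [MetricSpace X] [MeasurableSpace X] [BorelSpace X] [RCLike 𝕜]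
  {μ : Measure X} {lam : X → ℝ → ℝ} {K : X → X → 𝕜} {T : Lp 𝕜 2 μ →ₗ[𝕜] (X →ₘ[μ] 𝕜)}

theorem eLpNorm_apply_toLp_le {A : ℝ}
    (hA : ∀ f : Lp 𝕜 2 μ, eLpNorm (T f) 2 μ ≤ ENNReal.ofReal (A * ‖f‖)) {h : X → 𝕜}
    (hh : MemLp h 2 μ) : eLpNorm (T (hh.toLp h)) 2 μ ≤ ENNReal.ofReal A * eLpNorm h 2 μ := by
  refine (hA _).trans_eq ?_
  rw [ENNReal.ofReal_mul' (norm_nonneg _), Lp.norm_toLp, ENNReal.ofReal_toReal hh.2.ne]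

theorem setLIntegral_apply_balancer_le {A : ℝ}
    (hA : ∀ f : Lp 𝕜 2 μ, eLpNorm (T f) 2 μ ≤ ENNReal.ofReal (A * ‖f‖)) {b : X → 𝕜}
    {S V : Set X} (hSm : MeasurableSet S) (h0 : 0 < μ.real S) {κ : ℝ} (hκ : 1 ≤ κ)
    (hV : μ V ≤ ENNReal.ofReal κ * μ S) (hφ : MemLp (balancer μ b S) 2 μ) :
    ∫⁻ y in V, ‖T (hφ.toLp _) y‖ₑ ∂μ ≤ ENNReal.ofReal (A * κ) * ∫⁻ y, ‖b y‖ₑ ∂μ := by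
  have e : ENNReal.ofReal κ * μ S =
      (ENNReal.ofReal κ * μ S) ^ (1 / 2 : ℝ) * (ENNReal.ofReal κ * μ S) ^ (1 / 2 : ℝ) := by
    rw [← ENNReal.rpow_add_of_nonneg _ _ (by norm_num) (by norm_num)]
    norm_num
  have hS : μ S ≤ ENNReal.ofReal κ * μ S :=
    le_mul_of_one_le_left' (ENNReal.one_le_ofReal.2 hκ)
  calc ∫⁻ y in V, ‖T (hφ.toLp _) y‖ₑ ∂μ = eLpNorm (T (hφ.toLp _)) 1 (μ.restrict V) :=
        eLpNorm_one_eq_lintegral_enorm.symm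
    _ ≤ eLpNorm (T (hφ.toLp _)) 2 (μ.restrict V) *
          (μ.restrict V) univ ^ (1 / (1 : ℝ≥0∞).toReal - 1 / (2 : ℝ≥0∞).toReal) :=
        eLpNorm_le_eLpNorm_mul_rpow_measure_univ one_le_two
          (AEEqFun.aestronglyMeasurable _).restrict
    _ ≤ (ENNReal.ofReal A * (‖(∫ y, b y ∂μ) / (μ.real S : 𝕜)‖ₑ * μ S ^ (1 / 2 : ℝ))) *
          μ V ^ (1 / 2 : ℝ) := by
        gcongr
        · refine (eLpNorm_restrict_le _ _ _ _).trans ((eLpNorm_apply_toLp_le hA hφ).trans ?_)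
          gcongr
          rw [balancer, eLpNorm_indicator_const hSm (by norm_num) (by norm_num)]
          norm_num
        · simp
          norm_num
    _ ≤ (ENNReal.ofReal A * (‖(∫ y, b y ∂μ) / (μ.real S : 𝕜)‖ₑ *
          (ENNReal.ofReal κ * μ S) ^ (1 / 2 : ℝ))) * (ENNReal.ofReal κ * μ S) ^ (1 / 2 : ℝ) := by
        gcongr
    _ = ENNReal.ofReal A * ENNReal.ofReal κ *
          (‖(∫ y, b y ∂μ) / (μ.real S : 𝕜)‖ₑ * μ S) := by
        rw [mul_assoc, mul_assoc, ← e]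
        ring
    _ ≤ ENNReal.ofReal (A * κ) * ∫⁻ y, ‖b y‖ₑ ∂μ := by
        rw [ENNReal.ofReal_mul' (by linarith)]
        gcongr
        exact enorm_mul_measure_le h0

theorem IsCalderonZygmundOperator.exists_balanced_bound (hμ : IsUpperDoubling μ lam)
    (hT : IsCalderonZygmundOperator μ lam K T) (hT2 : IsBoundedOnL2 T) :
    ∃ Λ₀ : ℝ, ∀ Λ D : ℝ, 1 < Λ → Λ₀ ≤ Λ → 1 ≤ D →
      (∀ x r, 0 < r → lam x (Λ * r) ≤ D * lam x r) →
      ∃ C : ℝ, 0 ≤ C ∧ ∀ (z : X) (r : ℝ) (k : ℕ) (b : X → 𝕜) (S V : Set X)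
        (hb : MemLp b 2 μ) (hφ : MemLp (balancer μ b S) 2 μ),
        0 < r → IsFirstDoublingExponent μ Λ D z r k → MemLp b ⊤ μ →
        Function.support b ⊆ ball z r → MeasurableSet S → S ⊆ ball z (Λ ^ k * r) → 0 < μ.real S →
        μ.real (ball z (Λ ^ k * r)) ≤ 2 * μ.real S → MeasurableSet V → V ⊆ (ball z (2 * r))ᶜ →
        ∫⁻ y in V, ‖T (hb.toLp b - hφ.toLp _) y‖ₑ ∂μ ≤ ENNReal.ofReal C * ∫⁻ y, ‖b y‖ₑ ∂μ := by
  obtain ⟨A, hA⟩ := hT2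
  obtain ⟨C₁, δ, Λ₀, hC₁, hδ, hfar⟩ := hT.1.exists_far_bound hμ
  obtain ⟨C₂, hC₂, hnear⟩ := hT.1.exists_near_bound hμ
  refine ⟨Λ₀, fun Λ D hΛ hΛ₀ hD hlam => ?_⟩
  have hq : 0 < 1 - (Λ ^ δ)⁻¹ := by
    have := inv_lt_one_of_one_lt₀ (Real.one_lt_rpow hΛ hδ)
    linarith
  refine ⟨C₁ * 2 * (D / (1 - (Λ ^ δ)⁻¹)) + (C₂ * (4 * D) + max A 0 * (4 * D)), by positivity, ?_⟩
  intro z r k b S V hb hφ hr hk hbtop hsupp hSm hSsub hS0 hS2 hVm hV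
  set R := Λ ^ k * r with hR
  have hR0 : 0 < R := by positivity
  have hrR : r ≤ R := le_mul_of_one_le_left hr.le (one_le_pow₀ hΛ.le)
  have hSfin : μ S ≠ ∞ := fun h => by simp [measureReal_def, h] at hS0
  have hφtop : MemLp (balancer μ b S) ⊤ μ := memLp_balancer ⊤ hSm hSfin
  have hbint : Integrable b μ := memLp_one_iff_integrable.1
    (hb.mono_exponent_of_measure_support_ne_top (s := ball z r)
      (fun y hy => by_contra fun h => hy (hsupp h))
      (hμ.measure_ball_lt_top z r).ne one_le_two)
  have hφint : Integrable (balancer μ b S) μ :=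
    memLp_one_iff_integrable.1 (memLp_balancer 1 hSm hSfin)
  have hhs : Function.support (b - balancer μ b S) ⊆ ball z R :=
    (Function.support_sub _ _).trans (union_subset
      (hsupp.trans (ball_subset_ball hrR)) (support_balancer_subset.trans hSsub))
  have hfarT : ∀ᵐ x ∂μ, x ∈ V \ ball z (Λ * R) → ‖T (hb.toLp b - hφ.toLp _) x‖ₑ ≤
      ENNReal.ofReal (C₁ * 2) * (∫⁻ y, ‖b y‖ₑ ∂μ) *
        ENNReal.ofReal ((Λ * R) ^ δ / (dist x z ^ δ * lam z (dist x z))) := by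
    have := hT.2 (b - balancer μ b S) (hb.sub hφ) (hbtop.sub hφtop) (isBounded_ball.subset hhs)
    rw [MemLp.toLp_sub hb hφ] at this
    filter_upwards [this] with x hx hxV
    have hxd : Λ * R ≤ dist x z := not_lt.1 hxV.2
    have hRΛ : R < Λ * R := lt_mul_of_one_lt_left hR0 hΛ
    have hxs : x ∉ tsupport (b - balancer μ b S) := fun h => by
      have h1 : x ∈ closedBall z R :=
        closure_minimal (hhs.trans ball_subset_closedBall) isClosed_closedBall h
      have h2 := mem_closedBall.1 h1
      linarith
    have hlx := hμ.pos z (dist x z) (by linarith)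
    rw [hx hxs]
    refine (hfar Λ hΛ hΛ₀ x z R _ hR0 hhs (hbint.sub hφint) ?_ hxd).trans ?_
    · simp only [Pi.sub_apply]
      rw [integral_sub hbint hφint, integral_balancer hSm hS0, sub_self]
    · have h3 : ∫⁻ y, ‖(b - balancer μ b S) y‖ₑ ∂μ ≤ 2 * ∫⁻ y, ‖b y‖ₑ ∂μ :=
        calc ∫⁻ y, ‖(b - balancer μ b S) y‖ₑ ∂μ
            ≤ ∫⁻ y, ‖b y‖ₑ + ‖balancer μ b S y‖ₑ ∂μ :=
              lintegral_mono fun y => enorm_sub_le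
          _ = ∫⁻ y, ‖b y‖ₑ ∂μ + ∫⁻ y, ‖balancer μ b S y‖ₑ ∂μ :=
              lintegral_add_left' hbint.1.enorm _
          _ ≤ ∫⁻ y, ‖b y‖ₑ ∂μ + ∫⁻ y, ‖b y‖ₑ ∂μ := by
              exact add_le_add le_rfl (lintegral_enorm_balancer_le hSm hS0)
          _ = _ := (two_mul _).symm
      rw [ENNReal.ofReal_mul hC₁, ENNReal.ofReal_ofNat, mul_assoc (ENNReal.ofReal C₁) 2]
      gcongr
  have hnearT : ∀ᵐ x ∂μ, x ∈ V ∩ ball z (Λ * R) → ‖T (hb.toLp b) x‖ₑ ≤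
      ENNReal.ofReal C₂ * (∫⁻ y, ‖b y‖ₑ ∂μ) * ENNReal.ofReal (1 / lam z (dist x z)) := by
    filter_upwards [hT.2 b hb hbtop (isBounded_ball.subset hsupp)] with x hx hxV
    have hxd : 2 * r ≤ dist x z := not_lt.1 (hV hxV.1)
    have hxs : x ∉ tsupport b := fun h => by
      have h1 : x ∈ closedBall z r :=
        closure_minimal (hsupp.trans ball_subset_closedBall) isClosed_closedBall h
      have h2 := mem_closedBall.1 h1
      linarith
    rw [hx hxs]
    exact hnear x z r b hr hsupp hxd
  have hV1m : MeasurableSet (V \ ball z (Λ * R)) := hVm.diff measurableSet_ball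
  have hV2m : MeasurableSet (V ∩ ball z (Λ * R)) := hVm.inter measurableSet_ball
  have hΛR : Λ ^ (k + 1) * r = Λ * R := by rw [hR]; ring
  have I1 := hμ.setLIntegral_compl_ball_le hD hΛ hlam hδ (by positivity) hV1m
    (fun y hy => hy.2) hfarT
  have I2 := hk.setLIntegral_le hμ hD hΛ hlam hr hV2m (fun y hy => ⟨hΛR ▸ hy.2, fun h =>
    hV hy.1 (ball_subset_ball (by linarith) h)⟩) hnearT
  have I3 : ∫⁻ y in V ∩ ball z (Λ * R), ‖T (hφ.toLp _) y‖ₑ ∂μ ≤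
      ENNReal.ofReal (A * (4 * D)) * ∫⁻ y, ‖b y‖ₑ ∂μ := by
    refine setLIntegral_apply_balancer_le hA hSm hS0 (by linarith) ?_ hφ
    refine (measure_mono inter_subset_right).trans ?_
    rw [← ENNReal.ofReal_toReal hSfin, ← ENNReal.ofReal_mul (by positivity),
      ← ENNReal.ofReal_toReal (hμ.measure_ball_lt_top z (Λ * R)).ne]
    refine ENNReal.ofReal_le_ofReal ?_
    have := hk.1
    rw [hΛR] at this
    calc μ.real (ball z (Λ * R)) ≤ 2 * D * μ.real (ball z R) := this
      _ ≤ 2 * D * (2 * μ.real S) := by gcongr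
      _ = 4 * D * μ.real S := by ring
  have I23 : ∫⁻ y in V ∩ ball z (Λ * R), ‖T (hb.toLp b - hφ.toLp _) y‖ₑ ∂μ ≤
      ENNReal.ofReal C₂ * (∫⁻ y, ‖b y‖ₑ ∂μ) * ENNReal.ofReal (4 * D) +
        ENNReal.ofReal (A * (4 * D)) * ∫⁻ y, ‖b y‖ₑ ∂μ := by
    refine le_trans ?_ (add_le_add I2 I3)
    rw [← lintegral_add_left' (AEEqFun.aestronglyMeasurable _).restrict.enorm]
    refine lintegral_mono_ae (ae_restrict_of_ae ?_)
    rw [map_sub]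
    filter_upwards [AEEqFun.coeFn_sub (T (hb.toLp b)) (T (hφ.toLp _))] with y hy
    rw [hy]
    exact enorm_sub_le
  rw [← lintegral_inter_add_sdiff _ V measurableSet_ball (B := ball z (Λ * R))]
  refine (add_le_add I23 I1).trans ?_
  have hAmax : ENNReal.ofReal (A * (4 * D)) ≤ ENNReal.ofReal (max A 0 * (4 * D)) := by
    gcongr
    exact le_max_left _ _
  have e₁ : ENNReal.ofReal (C₁ * 2 * (D / (1 - (Λ ^ δ)⁻¹))) =
      ENNReal.ofReal (C₁ * 2) * ENNReal.ofReal (D / (1 - (Λ ^ δ)⁻¹)) :=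
    ENNReal.ofReal_mul (by positivity)
  have e₂ : ENNReal.ofReal (C₂ * (4 * D)) = ENNReal.ofReal C₂ * ENNReal.ofReal (4 * D) :=
    ENNReal.ofReal_mul hC₂
  rw [ENNReal.ofReal_add (by positivity) (by positivity),
    ENNReal.ofReal_add (by positivity) (by positivity), e₁, e₂]
  refine (add_le_add (add_le_add le_rfl (mul_le_mul' hAmax le_rfl)) le_rfl).trans_eq ?_
  ring

end Balanced

section Decomposition

set_option linter.unusedSectionVars false

variable {X 𝕜 : Type*} [MetricSpace X] [MeasurableSpace X] [BorelSpace X] [RCLike 𝕜]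
  {μ : Measure X}

/-- Finitely many functions living on balls can be balanced by multiples of indicator functions of
large subsets of these balls in such a way that the sum of the latter stays bounded. -/
theorem exists_balancing_sets {ι : Type*} (s : Finset ι) (z : ι → X) (R : ι → ℝ)
    (b : ι → X → 𝕜) {τ : ℝ≥0∞} (hτ0 : τ ≠ 0) (hτ : τ ≠ ∞)
    (hfin : ∀ i, μ (ball (z i) (R i)) ≠ ∞) (hpos : ∀ i ∈ s, μ (ball (z i) (R i)) ≠ 0)
    (hsum : ∀ i ∈ s, ∀ u ⊆ s, (∀ j ∈ u, R j ≤ R i ∧ (ball (z j) (R j) ∩ ball (z i) (R i)).Nonempty) →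
      ∑ j ∈ u, ∫⁻ y, ‖b j y‖ₑ ∂μ ≤ τ * μ (ball (z i) (R i))) :
    ∃ S : ι → Set X, (∀ i, MeasurableSet (S i) ∧ S i ⊆ ball (z i) (R i)) ∧
      (∀ i ∈ s, 0 < μ.real (S i) ∧ μ.real (ball (z i) (R i)) ≤ 2 * μ.real (S i)) ∧
      ∀ x, ∑ i ∈ s, ‖balancer μ (b i) (S i) x‖ₑ ≤ 4 * τ := by
  classical
  induction s using Finset.induction_on_max_value R with
  | empty => exact ⟨fun _ => ∅, by simp, by simp, by simp⟩
  | insert i s his hmax ih =>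
    obtain ⟨S, hS, hS2, hSτ⟩ := ih (fun j hj => hpos j (Finset.mem_insert_of_mem hj))
      (fun j hj u hu => hsum j (Finset.mem_insert_of_mem hj) u
        (hu.trans (Finset.subset_insert _ _)))
    have hi0 := hpos i (Finset.mem_insert_self _ _)
    have hifin := hfin i
    set B := ball (z i) (R i) with hB
    set F : X → ℝ≥0∞ := fun x => ∑ j ∈ s, ‖balancer μ (b j) (S j) x‖ₑ with hF
    have hφm : ∀ j, Measurable fun x => ‖balancer μ (b j) (S j) x‖ₑ := fun j =>
      (measurable_const.indicator (hS j).1).enorm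
    have hFm : Measurable F := Finset.measurable_sum _ fun j _ => hφm j
    have hFint : ∫⁻ x in B, F x ∂μ ≤ τ * μ B := by
      rw [hF, lintegral_finsetSum _ fun j _ => hφm j]
      set u := s.filter fun j => (ball (z j) (R j) ∩ B).Nonempty with hu
      refine le_trans ?_ (hsum i (Finset.mem_insert_self _ _) u
        ((Finset.filter_subset _ _).trans (Finset.subset_insert _ _))
        fun j hj => ⟨hmax j (Finset.mem_filter.1 hj).1, (Finset.mem_filter.1 hj).2⟩)
      rw [hu, Finset.sum_filter]
      refine Finset.sum_le_sum fun j hj => ?_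
      split_ifs with hne
      · exact (setLIntegral_le_lintegral _ _).trans
          (lintegral_enorm_balancer_le (hS j).1 (hS2 j hj).1)
      · rw [setLIntegral_eq_zero measurableSet_ball]
        intro x hx
        have : x ∉ S j := fun h => hne ⟨x, (hS j).2 h, hx⟩
        simp [balancer, this]
    set E := B ∩ {x | F x < 2 * τ} with hE
    have hEm : MeasurableSet E := measurableSet_ball.inter (measurableSet_lt hFm measurable_const)
    have hEB : E ⊆ B := inter_subset_left
    have hEfin : μ E ≠ ∞ := ne_top_of_le_ne_top hifin (measure_mono hEB)
    have hBE : 2 * μ (B \ E) ≤ μ B := by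
      have h1 : 2 * τ * (μ.restrict B) {x | 2 * τ ≤ F x} ≤ τ * μ B :=
        (mul_meas_ge_le_lintegral₀ hFm.aemeasurable _).trans hFint
      have h2 : μ (B \ E) ≤ (μ.restrict B) {x | 2 * τ ≤ F x} := by
        rw [Measure.restrict_apply (measurableSet_le measurable_const hFm)]
        refine measure_mono fun x hx => ⟨?_, hx.1⟩
        by_contra h
        exact hx.2 ⟨hx.1, by simpa using h⟩
      have h3 : τ * (2 * μ (B \ E)) ≤ τ * μ B :=
        calc τ * (2 * μ (B \ E)) = 2 * τ * μ (B \ E) := by ring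
          _ ≤ 2 * τ * (μ.restrict B) {x | 2 * τ ≤ F x} := by gcongr
          _ ≤ _ := h1
      exact (ENNReal.mul_le_mul_iff_right hτ0 hτ).1 h3
    have hreal : μ.real B ≤ 2 * μ.real E := by
      have h1 : μ.real (B \ E) + μ.real E = μ.real B := by
        have := measureReal_sdiff_add_inter (μ := μ) (s := B) hEm hifin
        rwa [inter_eq_self_of_subset_right hEB] at this
      have h2 : 2 * μ.real (B \ E) ≤ μ.real B := by
        have := ENNReal.toReal_mono hifin hBE
        simpa [ENNReal.toReal_mul, measureReal_def] using this
      linarith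
    have hB0 : 0 < μ.real B := ENNReal.toReal_pos hi0 hifin
    have hE0 : 0 < μ.real E := by linarith
    have hE0' : μ E ≠ 0 := fun h => by simp [measureReal_def, h] at hE0
    have ha : ‖(∫ y, b i y ∂μ) / (μ.real E : 𝕜)‖ₑ ≤ 2 * τ := by
      have h1 : ∫⁻ y, ‖b i y‖ₑ ∂μ ≤ τ * μ B := by
        have hne : 0 < R i := nonempty_ball.1 (nonempty_of_measure_ne_zero hi0)
        simpa using hsum i (Finset.mem_insert_self _ _) {i} (by simp) (by simpa using hne)
      have h2 : μ B ≤ 2 * μ E := by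
        rw [← ENNReal.ofReal_toReal hifin, ← ENNReal.ofReal_toReal hEfin,
          ← ENNReal.ofReal_ofNat 2, ← ENNReal.ofReal_mul (by norm_num)]
        exact ENNReal.ofReal_le_ofReal hreal
      refine (ENNReal.mul_le_mul_iff_left hE0' hEfin).1 ?_
      calc _ ≤ ∫⁻ y, ‖b i y‖ₑ ∂μ := enorm_mul_measure_le hE0
        _ ≤ τ * μ B := h1
        _ ≤ τ * (2 * μ E) := by gcongr
        _ = 2 * τ * μ E := by ring
    have hupd : ∀ j ∈ s, Function.update S i E j = S j := fun j hj =>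
      Function.update_of_ne (by rintro rfl; exact his hj) _ _
    refine ⟨Function.update S i E, fun j => ?_, fun j hj => ?_, fun x => ?_⟩
    · rcases eq_or_ne j i with rfl | hj
      · simpa using ⟨hEm, hEB⟩
      · simpa [Function.update_of_ne hj] using hS j
    · rcases Finset.mem_insert.1 hj with rfl | hj
      · simpa using ⟨hE0, hreal⟩
      · rw [hupd j hj]
        exact hS2 j hj
    · rw [Finset.sum_insert his, Function.update_self,
        Finset.sum_congr rfl fun j hj => by rw [hupd j hj]]
      by_cases hx : x ∈ E
      · calc ‖balancer μ (b i) E x‖ₑ + F x ≤ 2 * τ + 2 * τ := by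
              refine add_le_add ?_ hx.2.le
              simpa [balancer, hx] using ha
          _ = 4 * τ := by ring
      · simpa [balancer, hx] using hSτ x

theorem exists_disjoint_refinement [SecondCountableTopology X] [Nonempty X] {Ω : Set X}
    (hΩ : IsOpen Ω) (ρ : X → ℝ) (hρ : ∀ x ∈ Ω, 0 < ρ x) :
    ∃ (z : ℕ → X) (P : ℕ → Set X), (∀ n, MeasurableSet (P n)) ∧ Pairwise (Function.onFun Disjoint P) ∧
      ⋃ n, P n = Ω ∧ ∀ n, P n ⊆ ball (z n) (ρ (z n)) ∧ ((P n).Nonempty → z n ∈ Ω) := by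
  rcases Ω.eq_empty_or_nonempty with rfl | hne
  · exact ⟨fun _ => Classical.arbitrary X, fun _ => ∅, by simp, fun _ _ _ => by simp, by simp,
      by simp⟩
  obtain ⟨J, hJΩ, hJc, hJ⟩ := TopologicalSpace.isOpen_biUnion_countable Ω (fun x => ball x (ρ x))
    fun _ _ => isOpen_ball
  have hcov : Ω ⊆ ⋃ x ∈ J, ball x (ρ x) := fun x hx =>
    hJ ▸ mem_iUnion₂.2 ⟨x, hx, mem_ball_self (hρ x hx)⟩
  have hJne : J.Nonempty := by
    obtain ⟨x, hx⟩ := hne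
    obtain ⟨y, hy, -⟩ := mem_iUnion₂.1 (hcov hx)
    exact ⟨y, hy⟩
  obtain ⟨z, rfl⟩ := hJc.exists_eq_range hJne
  refine ⟨z, fun n => disjointed (fun n => ball (z n) (ρ (z n))) n ∩ Ω, fun n => ?_, ?_, ?_, ?_⟩
  · exact (MeasurableSet.disjointed (fun _ => measurableSet_ball) n).inter hΩ.measurableSet
  · exact fun m n hmn => ((disjoint_disjointed _) hmn).mono inter_subset_left inter_subset_left
  · rw [← iUnion_inter, iUnion_disjointed]
    refine inter_eq_self_of_subset_right fun x hx => ?_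
    simpa using hcov hx
  · exact fun n => ⟨inter_subset_left.trans (disjointed_subset _ _), fun _ => hJΩ (mem_range_self n)⟩

theorem exists_finset_setLIntegral_compl_le {P : ℕ → Set X} (hP : ∀ n, MeasurableSet (P n))
    (hd : Pairwise (Function.onFun Disjoint P)) {v : X → ℝ≥0∞} (hv : ∫⁻ x, v x ∂μ ≠ ∞) {ε : ℝ≥0∞}
    (hε : ε ≠ 0) :
    ∃ s : Finset ℕ, (∀ n ∈ s, μ (P n) ≠ 0) ∧
      ∫⁻ x in (⋃ n, P n) \ ⋃ n ∈ s, P n, v x ∂μ ≤ ε := by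
  classical
  set p : ℕ → ℝ≥0∞ := fun n => ∫⁻ x in P n, v x ∂μ with hp
  have hpt : ∑' n, p n ≠ ∞ := by
    rw [hp, ← lintegral_iUnion hP hd]
    exact ne_top_of_le_ne_top hv (setLIntegral_le_lintegral _ _)
  obtain ⟨s₀, hs₀⟩ := ((ENNReal.tendsto_tsum_compl_atTop_zero hpt).eventually
    (eventually_le_nhds hε.bot_lt)).exists
  set s := s₀.filter fun n => μ (P n) ≠ 0 with hs
  refine ⟨s, fun n hn => (Finset.mem_filter.1 hn).2, ?_⟩
  refine le_trans ?_ hs₀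
  calc ∫⁻ x in (⋃ n, P n) \ ⋃ n ∈ s, P n, v x ∂μ
      ≤ ∫⁻ x in ⋃ n : {n // n ∉ s}, P n, v x ∂μ := by
        refine lintegral_mono_set fun x hx => ?_
        obtain ⟨n, hn⟩ := mem_iUnion.1 hx.1
        exact mem_iUnion.2 ⟨⟨n, fun h => hx.2 (mem_iUnion₂.2 ⟨n, h, hn⟩)⟩, hn⟩
    _ ≤ ∑' n : {n // n ∉ s}, p n := lintegral_iUnion_le _ _
    _ = ∑' n, {n | n ∉ s}.indicator p n := tsum_subtype {n | n ∉ s} p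
    _ ≤ ∑' n, {n | n ∉ s₀}.indicator p n := by
        refine ENNReal.tsum_le_tsum fun n => ?_
        by_cases h0 : n ∈ s₀
        · by_cases h : n ∈ s
          · simp [h]
          · have : μ (P n) = 0 := by
              by_contra h'
              exact h (Finset.mem_filter.2 ⟨h0, h'⟩)
            have : p n = 0 := setLIntegral_measure_zero _ _ this
            simp [indicator_apply, this]
        · exact (indicator_le_self _ _ n).trans_eq (indicator_of_mem (s := {n | n ∉ s₀}) h0 p).symm
    _ = ∑' n : {n // n ∉ s₀}, p n := (tsum_subtype {n | n ∉ s₀} p).symm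

end Decomposition

section GoodPart

set_option linter.unusedSectionVars false

variable {X 𝕜 : Type*} [MetricSpace X] [MeasurableSpace X] [BorelSpace X] [RCLike 𝕜]
  {μ : Measure X} {lam : X → ℝ → ℝ} {K : X → X → 𝕜} {T : Lp 𝕜 2 μ →ₗ[𝕜] (X →ₘ[μ] 𝕜)}

theorem exists_isOpen_superlevel_subset [SecondCountableTopology X] [IsLocallyFiniteMeasure μ]
    {u : X → ℝ≥0∞} (hu : AEMeasurable u μ) (hu0 : ∫⁻ x, u x ∂μ ≠ 0) (hut : ∫⁻ x, u x ∂μ ≠ ∞)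
    {τ : ℝ≥0∞} (hτ0 : τ ≠ 0) (hτ : τ ≠ ∞) :
    ∃ Ω : Set X, IsOpen Ω ∧ {x | τ < u x} ⊆ Ω ∧ maximalSet μ u τ ⊆ Ω ∧
      τ * μ Ω ≤ 3 * ∫⁻ x, u x ∂μ := by
  set I := ∫⁻ x, u x ∂μ with hI
  have hF : τ * μ {x | τ < u x} ≤ I := by
    refine le_trans ?_ (mul_meas_ge_le_lintegral₀ hu τ)
    gcongr
    exact le_of_lt
  have hFt : μ {x | τ < u x} ≠ ∞ := fun h => by
    rw [h, ENNReal.mul_top hτ0] at hF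
    exact hut (top_le_iff.1 hF)
  obtain ⟨O, hFO, hO, hμO⟩ := Set.exists_isOpen_lt_add {x | τ < u x} hFt
    (ENNReal.div_pos hu0 hτ).ne'
  refine ⟨O ∪ maximalSet μ u τ, hO.union (isOpen_maximalSet μ u τ),
    hFO.trans subset_union_left, subset_union_right, ?_⟩
  calc τ * μ (O ∪ maximalSet μ u τ) ≤ τ * (μ O + μ (maximalSet μ u τ)) := by
        gcongr
        exact measure_union_le _ _
    _ ≤ τ * ((μ {x | τ < u x} + I / τ) + μ (maximalSet μ u τ)) := by
        gcongr
    _ = τ * μ {x | τ < u x} + τ * (I / τ) + τ * μ (maximalSet μ u τ) := by ring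
    _ ≤ I + I + I := by
        gcongr
        · exact ENNReal.mul_div_le
        · exact mul_measure_maximalSet_le μ u τ
    _ = 3 * I := by ring

theorem exists_calderonZygmund_decomposition [SecondCountableTopology X]
    (hμ : IsUpperDoubling μ lam) {Λ D : ℝ} (hΛ : 1 < Λ) (hΛ' : 95 ≤ Λ) (hD : 1 ≤ D)
    (hlam : ∀ x r, 0 < r → lam x (Λ * r) ≤ D * lam x r) {f : X → 𝕜} (hf2 : MemLp f 2 μ)
    (hf0 : ∫⁻ x, ‖f x‖ₑ ∂μ ≠ 0) (hft : ∫⁻ x, ‖f x‖ₑ ∂μ ≠ ∞) {τ : ℝ≥0∞} (hτ0 : τ ≠ 0)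
    (hτ : τ ≠ ∞) :
    ∃ Ω : Set X, MeasurableSet Ω ∧ τ * μ Ω ≤ 3 * ∫⁻ x, ‖f x‖ₑ ∂μ ∧ (Ω ≠ univ →
      ∃ (s : Finset ℕ) (z : ℕ → X) (r : ℕ → ℝ) (k : ℕ → ℕ) (P S : ℕ → Set X),
        (∀ n, MeasurableSet (P n)) ∧ Pairwise (Function.onFun Disjoint P) ∧
        (∀ n ∈ s, 0 < r n ∧ P n ⊆ ball (z n) (r n) ∧ ball (z n) (2 * r n) ⊆ Ω ∧
          IsFirstDoublingExponent μ Λ D (z n) (r n) (k n)) ∧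
        (∀ n, MeasurableSet (S n) ∧ μ (S n) ≠ ∞) ∧
        (∀ n ∈ s, S n ⊆ ball (z n) (Λ ^ k n * r n) ∧ 0 < μ.real (S n) ∧
          μ.real (ball (z n) (Λ ^ k n * r n)) ≤ 2 * μ.real (S n)) ∧
        (∀ x, ∑ n ∈ s, ‖balancer μ ((P n).indicator f) (S n) x‖ₑ ≤ ENNReal.ofReal (8 * D) * τ) ∧
        ∫⁻ x in (⋃ n ∈ s, P n)ᶜ, ‖f x‖ₑ ^ 2 ∂μ ≤ 2 * τ * ∫⁻ x, ‖f x‖ₑ ∂μ) := by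
  have := hμ.isLocallyFiniteMeasure
  set I := ∫⁻ x, ‖f x‖ₑ ∂μ with hI
  obtain ⟨Ω, hΩ, hFΩ, hmax, hΩτ⟩ := exists_isOpen_superlevel_subset hf2.1.enorm hf0 hft hτ0 hτ
  refine ⟨Ω, hΩ.measurableSet, hΩτ, fun hΩu => ?_⟩
  have hne : (Ωᶜ).Nonempty := nonempty_compl.2 hΩu
  have : Nonempty X := hne.to_type
  set ρ : X → ℝ := fun x => infDist x Ωᶜ / 10 with hρdef
  have hρ : ∀ x ∈ Ω, 0 < ρ x := fun x hx => by
    have := (hΩ.isClosed_compl.notMem_iff_infDist_pos hne).1 (not_not.2 hx : x ∉ Ωᶜ)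
    simp only [hρdef]
    positivity
  obtain ⟨z, P, hPm, hPd, hPΩ, hPz⟩ := exists_disjoint_refinement hΩ ρ hρ
  have hf2' : ∫⁻ x, ‖f x‖ₑ ^ 2 ∂μ ≠ ∞ := by
    have := lintegral_rpow_enorm_lt_top_of_eLpNorm_lt_top (by norm_num) (by norm_num) hf2.2
    simpa using this.ne
  obtain ⟨s, hs0, hs⟩ := exists_finset_setLIntegral_compl_le hPm hPd hf2' (mul_ne_zero hτ0 hf0)
  rw [hPΩ] at hs
  have hzΩ : ∀ n ∈ s, z n ∈ Ω := fun n hn => (hPz n).2 (nonempty_of_measure_ne_zero (hs0 n hn))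
  have hr : ∀ n ∈ s, 0 < ρ (z n) := fun n hn => hρ _ (hzΩ n hn)
  have hk : ∀ n, ∃ k, n ∈ s → IsFirstDoublingExponent μ Λ D (z n) (ρ (z n)) k := by
    intro n
    by_cases hn : n ∈ s
    · obtain ⟨k, hk⟩ := hμ.exists_isFirstDoublingExponent hD hΛ hlam (hr n hn)
        (ENNReal.toReal_pos (fun h => hs0 n hn (measure_mono_null (hPz n).1 h))
          (hμ.measure_ball_lt_top _ _).ne)
      exact ⟨k, fun _ => hk⟩
    · exact ⟨0, fun h => absurd h hn⟩
  choose k hk using hk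
  have hrR : ∀ n ∈ s, ρ (z n) ≤ Λ ^ k n * ρ (z n) := fun n hn =>
    le_mul_of_one_le_left (hr n hn).le (one_le_pow₀ hΛ.le)
  obtain ⟨S, hS, hS2, hSτ⟩ := exists_balancing_sets (μ := μ) s z (fun n => Λ ^ k n * ρ (z n))
    (fun n => (P n).indicator f) (τ := ENNReal.ofReal (2 * D) * τ)
    (mul_ne_zero (by simp; linarith) hτ0) (ENNReal.mul_ne_top ENNReal.ofReal_ne_top hτ)
    (fun n => (hμ.measure_ball_lt_top _ _).ne)
    (fun n hn h => hs0 n hn (measure_mono_null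
      ((hPz n).1.trans (ball_subset_ball (hrR n hn))) h))
    (by
      intro i hi u hus hu
      have hri := hr i hi
      have hRi := hrR i hi
      obtain ⟨w, hw, hiw⟩ : ∃ w ∈ Ωᶜ, dist (z i) w < 11 * ρ (z i) := by
        refine (infDist_lt_iff hne).1 ?_
        have : infDist (z i) Ωᶜ = 10 * ρ (z i) := by simp only [hρdef]; ring
        linarith
      set R := Λ ^ k i * ρ (z i) with hR
      have hsub : ⋃ j ∈ u, P j ⊆ ball w (14 * R) := by
        refine iUnion₂_subset fun j hj y hy => ?_
        obtain ⟨h1, v, hv1, hv2⟩ := hu j hj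
        have h2 : dist y (z j) < ρ (z j) := (hPz j).1 hy
        have h3 := hrR j (hus hj)
        have h4 : dist v (z j) < Λ ^ k j * ρ (z j) := hv1
        have h5 : dist v (z i) < R := hv2
        have h6 := dist_triangle4 y (z j) v (z i)
        have h7 := dist_triangle y (z i) w
        rw [dist_comm (z j) v] at h6
        refine mem_ball.2 ?_
        linarith
      calc ∑ j ∈ u, ∫⁻ y, ‖(P j).indicator f y‖ₑ ∂μ = ∑ j ∈ u, ∫⁻ y in P j, ‖f y‖ₑ ∂μ := by
            simp_rw [enorm_indicator_eq_indicator_enorm, lintegral_indicator (hPm _)]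
        _ = ∫⁻ y in ⋃ j ∈ u, P j, ‖f y‖ₑ ∂μ :=
            (lintegral_biUnion_finset (fun a _ b _ hab => hPd hab) (fun j _ => hPm j) _).symm
        _ ≤ ∫⁻ y in ball w (14 * R), ‖f y‖ₑ ∂μ := lintegral_mono_set hsub
        _ ≤ τ * μ (ball w (6 * (14 * R))) :=
            setLIntegral_ball_le_of_notMem_maximalSet (fun h => hw (hmax h)) _
        _ ≤ τ * μ (ball (z i) (Λ ^ (k i + 1) * ρ (z i))) := by
            gcongr
            refine ball_subset_ball' ?_
            have : Λ ^ (k i + 1) * ρ (z i) = Λ * R := by rw [hR]; ring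
            rw [this, dist_comm]
            have : 95 * R ≤ Λ * R := by
              gcongr
            linarith
        _ ≤ τ * (ENNReal.ofReal (2 * D) * μ (ball (z i) R)) := by
            gcongr
            rw [← ENNReal.ofReal_toReal (hμ.measure_ball_lt_top (z i) R).ne,
              ← ENNReal.ofReal_mul (by positivity),
              ← ENNReal.ofReal_toReal (hμ.measure_ball_lt_top (z i) (Λ ^ (k i + 1) * ρ (z i))).ne]
            exact ENNReal.ofReal_le_ofReal (hk i hi).1
        _ = _ := by ring)
  refine ⟨s, z, fun n => ρ (z n), k, P, S, hPm, hPd, fun n hn => ⟨hr n hn, (hPz n).1, ?_, hk n hn⟩,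
    fun n => ⟨(hS n).1, ne_top_of_le_ne_top (hμ.measure_ball_lt_top _ _).ne
      (measure_mono (hS n).2)⟩, fun n hn => ⟨(hS n).2, hS2 n hn⟩, fun x => ?_, ?_⟩
  · intro y hy
    by_contra h
    have h1 : infDist (z n) Ωᶜ ≤ dist (z n) y := infDist_le_dist_of_mem h
    have h2 : dist y (z n) < 2 * ρ (z n) := hy
    have h3 : infDist (z n) Ωᶜ = 10 * ρ (z n) := by simp only [hρdef]; ring
    have h4 := hr n hn
    rw [dist_comm] at h1
    linarith
  · refine (hSτ x).trans_eq ?_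
    rw [← mul_assoc, ← ENNReal.ofReal_ofNat 4, ← ENNReal.ofReal_mul (by norm_num)]
    congr 2
    ring
  · have hsub : (⋃ n ∈ s, P n)ᶜ ⊆ Ωᶜ ∪ (Ω \ ⋃ n ∈ s, P n) := fun x hx => by
      by_cases h : x ∈ Ω
      · exact Or.inr ⟨h, hx⟩
      · exact Or.inl h
    calc ∫⁻ x in (⋃ n ∈ s, P n)ᶜ, ‖f x‖ₑ ^ 2 ∂μ
        ≤ ∫⁻ x in Ωᶜ ∪ (Ω \ ⋃ n ∈ s, P n), ‖f x‖ₑ ^ 2 ∂μ := lintegral_mono_set hsub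
      _ ≤ ∫⁻ x in Ωᶜ, ‖f x‖ₑ ^ 2 ∂μ + ∫⁻ x in Ω \ ⋃ n ∈ s, P n, ‖f x‖ₑ ^ 2 ∂μ :=
          lintegral_union_le _ _ _
      _ ≤ τ * I + τ * I := by
          refine add_le_add ?_ hs
          calc ∫⁻ x in Ωᶜ, ‖f x‖ₑ ^ 2 ∂μ ≤ ∫⁻ x in Ωᶜ, τ * ‖f x‖ₑ ∂μ := by
                refine setLIntegral_mono' hΩ.measurableSet.compl fun x hx => ?_
                rw [sq]
                gcongr
                by_contra! h
                exact hx (hFΩ h)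
            _ ≤ ∫⁻ x, τ * ‖f x‖ₑ ∂μ := setLIntegral_le_lintegral _ _
            _ = τ * I := lintegral_const_mul' _ _ hτ
      _ = 2 * τ * I := by ring

theorem mul_measure_lt_enorm_apply_le {A : ℝ}
    (hA : ∀ f : Lp 𝕜 2 μ, eLpNorm (T f) 2 μ ≤ ENNReal.ofReal (A * ‖f‖)) {h : X → 𝕜}
    (hh : MemLp h 2 μ) {τ I : ℝ≥0∞} (hτ0 : τ ≠ 0) (hτ : τ ≠ ∞)
    (hI : ∫⁻ x, ‖h x‖ₑ ^ 2 ∂μ ≤ τ * I) :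
    τ * μ {x | τ < ‖T (hh.toLp h) x‖ₑ} ≤ ENNReal.ofReal A ^ 2 * I := by
  have e : ∀ g : X → 𝕜, eLpNorm g 2 μ ^ 2 = ∫⁻ x, ‖g x‖ₑ ^ 2 ∂μ := fun g => by
    have := eLpNorm_nnreal_pow_eq_lintegral (f := g) (μ := μ) (p := 2) (by norm_num)
    simpa using this
  refine (ENNReal.mul_le_mul_iff_right hτ0 hτ).1 ?_
  calc τ * (τ * μ {x | τ < ‖T (hh.toLp h) x‖ₑ})
      ≤ τ ^ 2 * μ {x | τ ^ 2 ≤ ‖T (hh.toLp h) x‖ₑ ^ 2} := by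
        rw [← mul_assoc, sq]
        gcongr with x
        intro hx
        rw [← sq]
        gcongr
    _ ≤ ∫⁻ x, ‖T (hh.toLp h) x‖ₑ ^ 2 ∂μ :=
        mul_meas_ge_le_lintegral₀ ((AEEqFun.aestronglyMeasurable _).enorm.pow_const _) _
    _ = eLpNorm (T (hh.toLp h)) 2 μ ^ 2 := (e _).symm
    _ ≤ (ENNReal.ofReal A * eLpNorm h 2 μ) ^ 2 := by
        gcongr
        exact eLpNorm_apply_toLp_le hA hh
    _ = ENNReal.ofReal A ^ 2 * ∫⁻ x, ‖h x‖ₑ ^ 2 ∂μ := by rw [mul_pow, e]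
    _ ≤ ENNReal.ofReal A ^ 2 * (τ * I) := by gcongr
    _ = τ * (ENNReal.ofReal A ^ 2 * I) := by ring

theorem AEEqFun.enorm_sum_le {ι : Type*} (s : Finset ι) (F : ι → X →ₘ[μ] 𝕜) :
    ∀ᵐ x ∂μ, ‖(∑ n ∈ s, F n : X →ₘ[μ] 𝕜) x‖ₑ ≤ ∑ n ∈ s, ‖F n x‖ₑ := by
  classical
  induction s using Finset.induction_on with
  | empty =>
    filter_upwards [AEEqFun.coeFn_zero (α := X) (β := 𝕜) (μ := μ)] with x hx
    rw [Finset.sum_empty, hx]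
    simp
  | insert i s his ih =>
    rw [Finset.sum_insert his]
    filter_upwards [ih, AEEqFun.coeFn_add (F i) (∑ n ∈ s, F n)] with x hx hx'
    rw [hx', Finset.sum_insert his]
    exact (enorm_add_le _ _).trans (by gcongr)

theorem toLp_finset_sum {ι : Type*} (s : Finset ι) {F : ι → X → 𝕜} (hF : ∀ n, MemLp (F n) 2 μ)
    (hs : MemLp (fun x => ∑ n ∈ s, F n x) 2 μ) :
    hs.toLp _ = ∑ n ∈ s, (hF n).toLp (F n) := by
  classical
  induction s using Finset.induction_on with
  | empty =>
    simp only [Finset.sum_empty]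
    exact MemLp.toLp_zero _
  | insert i s his ih =>
    rw [Finset.sum_insert his, ← ih (memLp_finsetSum s fun n _ => hF n), ← MemLp.toLp_add]
    congr 1
    ext x
    simp [Finset.sum_insert his]

end GoodPart

section WeakBound

variable {X 𝕜 : Type*} [MetricSpace X] [MeasurableSpace X] [BorelSpace X] [RCLike 𝕜]
  {μ : Measure X} {lam : X → ℝ → ℝ} {K : X → X → 𝕜} {T : Lp 𝕜 2 μ →ₗ[𝕜] (X →ₘ[μ] 𝕜)}

theorem IsCalderonZygmundOperator.exists_weak_bound_of_memLp_top [SecondCountableTopology X]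
    (hμ : IsUpperDoubling μ lam) (hT : IsCalderonZygmundOperator μ lam K T)
    (hT2 : IsBoundedOnL2 T) :
    ∃ C : ℝ≥0∞, C ≠ ∞ ∧ ∀ (f : X → 𝕜) (hf : MemLp f 2 μ), MemLp f ⊤ μ →
      Bornology.IsBounded (Function.support f) → ∀ τ : ℝ≥0∞, τ ≠ 0 → τ ≠ ∞ →
      τ * μ {x | 3 * τ < ‖T (hf.toLp f) x‖ₑ} ≤ C * ∫⁻ x, ‖f x‖ₑ ∂μ := by
  obtain ⟨Λ₀, hbal⟩ := hT.exists_balanced_bound hμ hT2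
  obtain ⟨A, hA⟩ := hT2
  obtain ⟨Λ, D, hΛ, hΛ', hD, hlam⟩ := hμ.exists_dilation (max Λ₀ 95)
  obtain ⟨C, -, hC⟩ := hbal Λ D hΛ ((le_max_left _ _).trans hΛ') hD hlam
  refine ⟨3 + ENNReal.ofReal C + ENNReal.ofReal A ^ 2 * 2 +
    ENNReal.ofReal A ^ 2 * ENNReal.ofReal (8 * D), by finiteness,
    fun f hf hftop hfb τ hτ0 hτ => ?_⟩
  set I := ∫⁻ x, ‖f x‖ₑ ∂μ with hI
  have hτ3 : τ ≤ 3 * τ := le_mul_of_one_le_left' (by norm_num)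
  by_cases hI0 : I = 0
  · have hf0 : ∀ᵐ x ∂μ, ‖f x‖ₑ = 0 := (lintegral_eq_zero_iff' hf.1.enorm).1 hI0
    have h1 : ∫⁻ x, ‖f x‖ₑ ^ 2 ∂μ ≤ τ * 0 := by
      rw [mul_zero, nonpos_iff_eq_zero]
      refine lintegral_eq_zero_of_ae_eq_zero ?_
      filter_upwards [hf0] with x hx
      simp [hx]
    have h2 := mul_measure_lt_enorm_apply_le hA hf hτ0 hτ h1
    rw [mul_zero] at h2
    refine le_trans ?_ (h2.trans zero_le)
    gcongr
  have hIt : I ≠ ∞ := by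
    rcases isEmpty_or_nonempty X with hX | ⟨⟨x⟩⟩
    · simp [hI, Measure.eq_zero_of_isEmpty μ]
    obtain ⟨r, hr⟩ := hfb.subset_ball x
    have := hf.mono_exponent_of_measure_support_ne_top (s := ball x r)
      (fun y hy => by_contra fun h => hy (hr h)) (hμ.measure_ball_lt_top x r).ne one_le_two
    rw [hI, ← eLpNorm_one_eq_lintegral_enorm]
    exact this.2.ne
  obtain ⟨Ω, hΩm, hΩ, hdec⟩ := exists_calderonZygmund_decomposition hμ hΛ
    ((le_max_right _ _).trans hΛ') hD hlam hf hI0 hIt hτ0 hτ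
  by_cases hΩu : Ω = univ
  · calc τ * μ {x | 3 * τ < ‖T (hf.toLp f) x‖ₑ} ≤ τ * μ Ω := by
          gcongr
          rw [hΩu]
          exact subset_univ _
      _ ≤ 3 * I := hΩ
      _ ≤ _ := by
          gcongr
          rw [add_assoc, add_assoc]
          exact le_self_add
  obtain ⟨s, z, r, k, P, S, hPm, hPd, hP, hS, hS2, hφ, hgood⟩ := hdec hΩu
  set W := ⋃ n ∈ s, P n with hW
  have hWm : MeasurableSet W := Finset.measurableSet_biUnion s fun n _ => hPm n
  have hb : ∀ n, MemLp ((P n).indicator f) 2 μ := fun n => hf.indicator (hPm n)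
  have hφ2 : ∀ n, MemLp (balancer μ ((P n).indicator f) (S n)) 2 μ := fun n =>
    memLp_balancer 2 (hS n).1 (hS n).2
  have hg : MemLp (Wᶜ.indicator f) 2 μ := hf.indicator hWm.compl
  have hΦ : MemLp (fun x => ∑ n ∈ s, balancer μ ((P n).indicator f) (S n) x) 2 μ :=
    memLp_finsetSum s fun n _ => hφ2 n
  have hbI : ∑ n ∈ s, ∫⁻ x, ‖(P n).indicator f x‖ₑ ∂μ ≤ I := by
    simp_rw [enorm_indicator_eq_indicator_enorm, lintegral_indicator (hPm _)]
    rw [← lintegral_biUnion_finset (fun a _ b _ hab => hPd hab) (fun j _ => hPm j)]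
    exact setLIntegral_le_lintegral _ _
  set B : ℕ → X →ₘ[μ] 𝕜 := fun n => T ((hb n).toLp _ - (hφ2 n).toLp _) with hB
  have hTf : T (hf.toLp f) = T (hg.toLp _) + T (hΦ.toLp _) + ∑ n ∈ s, B n := by
    have h1 : hf.toLp f = hg.toLp _ + ∑ n ∈ s, (hb n).toLp _ := by
      rw [← toLp_finset_sum s hb (memLp_finsetSum s fun n _ => hb n), ← MemLp.toLp_add]
      congr 1
      ext x
      have h2 : ∑ n ∈ s, (P n).indicator f x = W.indicator f x := by
        rw [hW, Finset.indicator_biUnion_apply s P fun i _ j _ hij => hPd hij]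
      rw [Pi.add_apply, h2, indicator_compl_add_self_apply]
    rw [hB, ← map_sum, ← map_add, ← map_add, h1, toLp_finset_sum s hφ2 hΦ,
      Finset.sum_sub_distrib]
    congr 1
    abel
  have E1 : τ * μ {x | τ < ‖T (hg.toLp _) x‖ₑ} ≤ ENNReal.ofReal A ^ 2 * (2 * I) := by
    refine mul_measure_lt_enorm_apply_le hA hg hτ0 hτ ?_
    have h1 : ∀ x, ‖Wᶜ.indicator f x‖ₑ ^ 2 = Wᶜ.indicator (fun x => ‖f x‖ₑ ^ 2) x := fun x => by
      by_cases hx : x ∈ Wᶜ <;> simp [hx]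
    simp_rw [h1]
    rw [lintegral_indicator hWm.compl]
    exact hgood.trans_eq (by ring)
  have E2 : τ * μ {x | τ < ‖T (hΦ.toLp _) x‖ₑ} ≤
      ENNReal.ofReal A ^ 2 * (ENNReal.ofReal (8 * D) * I) := by
    refine mul_measure_lt_enorm_apply_le hA hΦ hτ0 hτ ?_
    have hφm : ∀ n, Measurable fun x => ‖balancer μ ((P n).indicator f) (S n) x‖ₑ := fun n =>
      (measurable_const.indicator (hS n).1).enorm
    calc ∫⁻ x, ‖∑ n ∈ s, balancer μ ((P n).indicator f) (S n) x‖ₑ ^ 2 ∂μ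
        ≤ ∫⁻ x, ENNReal.ofReal (8 * D) * τ *
            ∑ n ∈ s, ‖balancer μ ((P n).indicator f) (S n) x‖ₑ ∂μ := by
          refine lintegral_mono fun x => ?_
          have h1 := enorm_sum_le s fun n => balancer μ ((P n).indicator f) (S n) x
          rw [sq]
          exact mul_le_mul' (h1.trans (hφ x)) h1
      _ = ENNReal.ofReal (8 * D) * τ *
            ∑ n ∈ s, ∫⁻ x, ‖balancer μ ((P n).indicator f) (S n) x‖ₑ ∂μ := by
          rw [lintegral_const_mul _ (Finset.measurable_sum _ fun n _ => hφm n),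
            lintegral_finsetSum _ fun n _ => hφm n]
      _ ≤ ENNReal.ofReal (8 * D) * τ * I := by
          gcongr
          refine le_trans (Finset.sum_le_sum fun n hn => ?_) hbI
          exact lintegral_enorm_balancer_le (hS n).1 (hS2 n hn).2.1
      _ = τ * (ENNReal.ofReal (8 * D) * I) := by ring
  have hBm : ∀ n, AEMeasurable (fun x => ‖B n x‖ₑ) (μ.restrict Ωᶜ) := fun n =>
    (AEEqFun.aestronglyMeasurable _).restrict.enorm
  have E3 : τ * μ ({x | τ < ∑ n ∈ s, ‖B n x‖ₑ} ∩ Ωᶜ) ≤ ENNReal.ofReal C * I :=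
    calc τ * μ ({x | τ < ∑ n ∈ s, ‖B n x‖ₑ} ∩ Ωᶜ)
        = τ * (μ.restrict Ωᶜ) {x | τ < ∑ n ∈ s, ‖B n x‖ₑ} := by
          rw [Measure.restrict_apply' hΩm.compl]
      _ ≤ τ * (μ.restrict Ωᶜ) {x | τ ≤ ∑ n ∈ s, ‖B n x‖ₑ} := by
          gcongr
          exact le_of_lt
      _ ≤ ∫⁻ x in Ωᶜ, ∑ n ∈ s, ‖B n x‖ₑ ∂μ :=
          mul_meas_ge_le_lintegral₀ (Finset.aemeasurable_fun_sum _ fun n _ => hBm n) _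
      _ = ∑ n ∈ s, ∫⁻ x in Ωᶜ, ‖B n x‖ₑ ∂μ := lintegral_finsetSum' _ fun n _ => hBm n
      _ ≤ ∑ n ∈ s, ENNReal.ofReal C * ∫⁻ x, ‖(P n).indicator f x‖ₑ ∂μ := by
          refine Finset.sum_le_sum fun n hn => ?_
          obtain ⟨h1, h2, h3, h4⟩ := hP n hn
          obtain ⟨h5, h6, h7⟩ := hS2 n hn
          exact hC (z n) (r n) (k n) _ (S n) Ωᶜ (hb n) (hφ2 n) h1 h4 (hftop.indicator (hPm n))
            (support_indicator_subset.trans h2) (hS n).1 h5 h6 h7 hΩm.compl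
            (compl_subset_compl.2 h3)
      _ ≤ ENNReal.ofReal C * I := by
          rw [← Finset.mul_sum]
          gcongr
  have hsub : μ {x | 3 * τ < ‖T (hf.toLp f) x‖ₑ} ≤ μ (({x | τ < ‖T (hg.toLp _) x‖ₑ} ∪
      {x | τ < ‖T (hΦ.toLp _) x‖ₑ}) ∪ (({x | τ < ∑ n ∈ s, ‖B n x‖ₑ} ∩ Ωᶜ) ∪ Ω)) := by
    refine measure_mono_ae ?_
    rw [hTf]
    filter_upwards [AEEqFun.coeFn_add (T (hg.toLp _) + T (hΦ.toLp _)) (∑ n ∈ s, B n),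
      AEEqFun.coeFn_add (T (hg.toLp _)) (T (hΦ.toLp _)), AEEqFun.enorm_sum_le s B] with x h1 h2 h3
    intro (hx : 3 * τ < ‖_‖ₑ)
    rw [h1, Pi.add_apply, h2, Pi.add_apply] at hx
    change x ∈ (_ : Set X)
    by_contra h
    simp only [mem_union, mem_inter_iff, mem_compl_iff, not_or, mem_ofPred_eq, not_and,
      not_lt, not_not] at h
    obtain ⟨⟨ha, hb⟩, hc, hd⟩ := h
    have hc' : ∑ n ∈ s, ‖B n x‖ₑ ≤ τ := by
      by_contra! h'
      exact hd (hc h')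
    refine absurd hx (not_lt.2 ?_)
    calc _ ≤ τ + τ + τ := (enorm_add_le _ _).trans
          (add_le_add ((enorm_add_le _ _).trans (add_le_add ha hb)) (h3.trans hc'))
      _ = 3 * τ := by ring
  calc τ * μ {x | 3 * τ < ‖T (hf.toLp f) x‖ₑ}
      ≤ τ * ((μ {x | τ < ‖T (hg.toLp _) x‖ₑ} + μ {x | τ < ‖T (hΦ.toLp _) x‖ₑ}) +
          (μ ({x | τ < ∑ n ∈ s, ‖B n x‖ₑ} ∩ Ωᶜ) + μ Ω)) := by
        refine mul_le_mul' le_rfl (hsub.trans ((measure_union_le _ _).trans ?_))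
        exact add_le_add (measure_union_le _ _) (measure_union_le _ _)
    _ = (τ * μ {x | τ < ‖T (hg.toLp _) x‖ₑ} + τ * μ {x | τ < ‖T (hΦ.toLp _) x‖ₑ}) +
          (τ * μ ({x | τ < ∑ n ∈ s, ‖B n x‖ₑ} ∩ Ωᶜ) + τ * μ Ω) := by ring
    _ ≤ (ENNReal.ofReal A ^ 2 * (2 * I) + ENNReal.ofReal A ^ 2 * (ENNReal.ofReal (8 * D) * I)) +
          (ENNReal.ofReal C * I + 3 * I) := add_le_add (add_le_add E1 E2) (add_le_add E3 hΩ)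
    _ = _ := by ring

theorem exists_measurableSet_isBounded_truncation [Nonempty X] {f : X → 𝕜}
    (hf : StronglyMeasurable f) (hf2 : MemLp f 2 μ) {ε : ℝ≥0∞} (hε : ε ≠ 0) :
    ∃ E : Set X, MeasurableSet E ∧ Bornology.IsBounded E ∧ (∃ M : ℝ, ∀ x ∈ E, ‖f x‖ ≤ M) ∧
      ∫⁻ x, ‖Eᶜ.indicator f x‖ₑ ^ 2 ∂μ ≤ ε := by
  obtain ⟨x₀⟩ := ‹Nonempty X›
  set E : ℕ → Set X := fun n => ball x₀ n ∩ {x | ‖f x‖ ≤ n} with hE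
  have hEm : ∀ n, MeasurableSet (E n) := fun n =>
    measurableSet_ball.inter (measurableSet_le hf.norm.measurable measurable_const)
  have hf2' : ∫⁻ x, ‖f x‖ₑ ^ 2 ∂μ ≠ ∞ := by
    have := lintegral_rpow_enorm_lt_top_of_eLpNorm_lt_top (by norm_num) (by norm_num) hf2.2
    simpa using this.ne
  have hlim : Tendsto (fun n => ∫⁻ x, ‖(E n)ᶜ.indicator f x‖ₑ ^ 2 ∂μ) atTop
      (𝓝 (∫⁻ _, 0 ∂μ)) := by
    refine tendsto_lintegral_of_dominated_convergence (fun x => ‖f x‖ₑ ^ 2)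
      (fun n => ((hf.measurable.indicator (hEm n).compl).enorm.pow_const 2))
      (fun n => Eventually.of_forall fun x => ?_) hf2' (Eventually.of_forall fun x => ?_)
    · dsimp only
      gcongr
      rw [enorm_indicator_eq_indicator_enorm]
      exact indicator_le_self _ _ x
    · obtain ⟨N, hN⟩ := exists_nat_gt (max (dist x x₀) ‖f x‖)
      refine tendsto_const_nhds.congr' ?_
      filter_upwards [eventually_ge_atTop N] with n hn
      have hn' : (N : ℝ) ≤ n := by exact_mod_cast hn
      have : x ∈ E n := ⟨mem_ball.2 ((le_max_left _ _).trans_lt (hN.trans_le hn')),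
        ((le_max_right _ _).trans (hN.trans_le hn').le)⟩
      simp [this]
  rw [lintegral_zero] at hlim
  obtain ⟨n, hn⟩ := (hlim.eventually (eventually_le_nhds hε.bot_lt)).exists
  exact ⟨E n, hEm n, isBounded_ball.subset inter_subset_left, ⟨n, fun x hx => hx.2⟩, hn⟩

theorem IsCalderonZygmundOperator.exists_weak_bound [SecondCountableTopology X]
    (hμ : IsUpperDoubling μ lam) (hT : IsCalderonZygmundOperator μ lam K T)
    (hT2 : IsBoundedOnL2 T) :
    ∃ C : ℝ≥0∞, C ≠ ∞ ∧ ∀ f : Lp 𝕜 2 μ, ∀ τ : ℝ≥0∞, τ ≠ 0 → τ ≠ ∞ →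
      τ * μ {x | τ < ‖T f x‖ₑ} ≤ C * ∫⁻ x, ‖f x‖ₑ ∂μ := by
  obtain ⟨C, hCt, hC⟩ := hT.exists_weak_bound_of_memLp_top hμ hT2
  obtain ⟨A, hA⟩ := hT2
  refine ⟨4 * (C + ENNReal.ofReal A ^ 2), by finiteness, fun f τ' hτ0' hτ' => ?_⟩
  obtain ⟨τ, rfl⟩ : ∃ τ : ℝ≥0∞, τ' = 4 * τ := ⟨τ' / 4, by
    rw [ENNReal.mul_div_cancel (by norm_num) (by norm_num)]⟩
  have hτ0 : τ ≠ 0 := right_ne_zero_of_mul hτ0'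
  have hτ : τ ≠ ∞ := fun h => hτ' (by rw [h]; exact ENNReal.mul_top (by norm_num))
  rcases isEmpty_or_nonempty X with hX | hX
  · simp [Measure.eq_zero_of_isEmpty μ]
  have hf2 : MemLp f 2 μ := Lp.memLp f
  have hfm : StronglyMeasurable f := Lp.stronglyMeasurable f
  set I := ∫⁻ x, ‖f x‖ₑ ∂μ with hI
  by_cases hI0 : I = 0
  · have hf0 : f = 0 := by
      rw [Lp.eq_zero_iff_ae_eq_zero]
      filter_upwards [(lintegral_eq_zero_iff' hf2.1.enorm).1 hI0] with x hx
      simpa using hx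
    have h0 : μ {x | 4 * τ < ‖T f x‖ₑ} = 0 := by
      rw [hf0, map_zero, measure_eq_zero_iff_ae_notMem]
      filter_upwards [AEEqFun.coeFn_zero (α := X) (β := 𝕜) (μ := μ)] with x hx
      simp [hx]
    simp [h0]
  obtain ⟨E, hEm, hEb, ⟨M, hM⟩, hE⟩ := exists_measurableSet_isBounded_truncation hfm hf2
    (mul_ne_zero hτ0 hI0)
  have h1 : MemLp (E.indicator f) 2 μ := hf2.indicator hEm
  have h2 : MemLp (Eᶜ.indicator f) 2 μ := hf2.indicator hEm.compl
  have h3 : MemLp (E.indicator f) ⊤ μ := by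
    refine memLp_top_of_bound h1.1 (max M 0) (Eventually.of_forall fun x => ?_)
    by_cases hx : x ∈ E
    · simpa [hx] using Or.inl (hM x hx)
    · simp [hx]
  have hsum : f = h1.toLp _ + h2.toLp _ := by
    rw [← MemLp.toLp_add]
    refine (Lp.toLp_coeFn f hf2).symm.trans ?_
    congr 1
    exact (indicator_self_add_compl E f).symm
  have E1 := hC _ h1 h3 (hEb.subset support_indicator_subset) τ hτ0 hτ
  have E2 := mul_measure_lt_enorm_apply_le hA h2 hτ0 hτ hE
  have hsub : μ {x | 4 * τ < ‖T f x‖ₑ} ≤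
      μ ({x | 3 * τ < ‖T (h1.toLp _) x‖ₑ} ∪ {x | τ < ‖T (h2.toLp _) x‖ₑ}) := by
    refine measure_mono_ae ?_
    have h : T f = T (h1.toLp _) + T (h2.toLp _) := by rw [← map_add, ← hsum]
    rw [h]
    filter_upwards [AEEqFun.coeFn_add (T (h1.toLp _)) (T (h2.toLp _))] with x hx
    intro (hx' : 4 * τ < ‖_‖ₑ)
    rw [hx, Pi.add_apply] at hx'
    change x ∈ (_ : Set X)
    by_contra h
    simp only [not_or, mem_ofPred_eq, not_lt] at h
    refine absurd hx' (not_lt.2 ?_)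
    calc _ ≤ 3 * τ + τ := (enorm_add_le _ _).trans (add_le_add h.1 h.2)
      _ = 4 * τ := by ring
  have hIle : ∫⁻ x, ‖E.indicator f x‖ₑ ∂μ ≤ I := lintegral_mono fun x => by
    rw [enorm_indicator_eq_indicator_enorm]
    exact indicator_le_self _ _ x
  calc 4 * τ * μ {x | 4 * τ < ‖T f x‖ₑ}
      ≤ 4 * τ * (μ {x | 3 * τ < ‖T (h1.toLp _) x‖ₑ} + μ {x | τ < ‖T (h2.toLp _) x‖ₑ}) := by
        gcongr
        exact hsub.trans (measure_union_le _ _)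
    _ = 4 * (τ * μ {x | 3 * τ < ‖T (h1.toLp _) x‖ₑ} + τ * μ {x | τ < ‖T (h2.toLp _) x‖ₑ}) := by
        ring
    _ ≤ 4 * (C * I + ENNReal.ofReal A ^ 2 * I) := by
        refine mul_le_mul' le_rfl (add_le_add (E1.trans ?_) E2)
        gcongr
    _ = _ := by ring

end WeakBound

section Extension

variable {X 𝕜 : Type*} [MeasurableSpace X] [RCLike 𝕜] {μ : Measure X}

theorem ae_eq_zero_of_forall_mul_measure_le {F : X → 𝕜} {κ L : ℝ≥0∞} (hκ : κ ≠ ∞) (hL : L ≠ ∞)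
    (h : ∀ τ η : ℝ≥0∞, τ ≠ 0 → τ ≠ ∞ → η ≠ 0 → τ * μ {x | κ * τ < ‖F x‖ₑ} ≤ L * η) :
    ∀ᵐ x ∂μ, F x = 0 := by
  have h0 : ∀ τ : ℝ≥0∞, τ ≠ 0 → τ ≠ ∞ → μ {x | κ * τ < ‖F x‖ₑ} = 0 := by
    intro τ hτ0 hτ
    have h1 : τ * μ {x | κ * τ < ‖F x‖ₑ} ≤ 0 := by
      have : Tendsto (fun η => L * η) (𝓝[>] 0) (𝓝 (L * 0)) :=
        (ENNReal.Tendsto.const_mul tendsto_id (Or.inr hL)).mono_left nhdsWithin_le_nhds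
      rw [mul_zero] at this
      refine ge_of_tendsto this ?_
      filter_upwards [self_mem_nhdsWithin] with η hη
      exact h τ η hτ0 hτ (ne_of_gt hη)
    exact (mul_eq_zero.1 (nonpos_iff_eq_zero.1 h1)).resolve_left hτ0
  have h1 : ∀ n : ℕ, ∀ᵐ x ∂μ, ‖F x‖ₑ ≤ κ * (2⁻¹ : ℝ≥0∞) ^ n := by
    intro n
    have := h0 ((2⁻¹ : ℝ≥0∞) ^ n) (pow_ne_zero _ (by simp)) (ENNReal.pow_ne_top (by simp))
    rw [measure_eq_zero_iff_ae_notMem] at this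
    filter_upwards [this] with x hx
    simpa using hx
  filter_upwards [ae_all_iff.2 h1] with x hx
  have h2 : Tendsto (fun n : ℕ => κ * (2⁻¹ : ℝ≥0∞) ^ n) atTop (𝓝 (κ * 0)) :=
    ENNReal.Tendsto.const_mul (ENNReal.tendsto_pow_atTop_nhds_zero_of_lt_one (by simp))
      (Or.inr hκ)
  rw [mul_zero] at h2
  simpa using ge_of_tendsto' h2 hx

theorem exists_Lp_two_edist_lt (f : Lp 𝕜 1 μ) {ε : ℝ≥0∞} (hε : ε ≠ 0) :
    ∃ (w : Lp 𝕜 1 μ) (v : Lp 𝕜 2 μ), (w : X →ₘ[μ] 𝕜) = (v : X →ₘ[μ] 𝕜) ∧ edist f w < ε := by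
  obtain ⟨w, ⟨s, hs⟩, hw⟩ := EMetric.mem_closure_iff.1
    (Lp.simpleFunc.dense (E := 𝕜) (μ := μ) ENNReal.one_ne_top f) ε hε.bot_lt
  have h1 : MemLp s 1 μ := by
    refine (memLp_congr_ae ?_).1 (Lp.memLp w)
    rw [← hs]
    exact AEEqFun.coeFn_mk _ _
  have h2 : MemLp s 2 μ :=
    (SimpleFunc.memLp_iff (by norm_num) (by norm_num)).2
      ((SimpleFunc.memLp_iff (by norm_num) (by norm_num)).1 h1)
  exact ⟨w, h2.toLp s, hs.symm, hw⟩

variable {T : Lp 𝕜 2 μ →ₗ[𝕜] (X →ₘ[μ] 𝕜)} {C : ℝ≥0∞}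

theorem mul_measure_lt_enorm_sub_le
    (hT : ∀ f : Lp 𝕜 2 μ, ∀ τ : ℝ≥0∞, τ ≠ 0 → τ ≠ ∞ →
      τ * μ {x | τ < ‖T f x‖ₑ} ≤ C * ∫⁻ x, ‖f x‖ₑ ∂μ)
    {w w' : Lp 𝕜 1 μ} {v v' : Lp 𝕜 2 μ} (h : (w : X →ₘ[μ] 𝕜) = (v : X →ₘ[μ] 𝕜))
    (h' : (w' : X →ₘ[μ] 𝕜) = (v' : X →ₘ[μ] 𝕜)) {τ : ℝ≥0∞} (hτ0 : τ ≠ 0) (hτ : τ ≠ ∞) :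
    τ * μ {x | τ < ‖T v x - T v' x‖ₑ} ≤ C * edist w w' := by
  have e1 : μ {x | τ < ‖T v x - T v' x‖ₑ} = μ {x | τ < ‖T (v - v') x‖ₑ} := by
    rw [map_sub]
    refine measure_congr ?_
    filter_upwards [AEEqFun.coeFn_sub (T v) (T v')] with x hx
    change (τ < ‖T v x - T v' x‖ₑ) = (τ < ‖(T v - T v') x‖ₑ)
    rw [hx, Pi.sub_apply]
  have e2 : ∫⁻ x, ‖(v - v') x‖ₑ ∂μ = edist w w' := by
    rw [Lp.edist_def, eLpNorm_one_eq_lintegral_enorm, h, h']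
    refine lintegral_congr_ae ?_
    filter_upwards [Lp.coeFn_sub v v'] with x hx
    rw [hx]
  rw [e1, ← e2]
  exact hT _ τ hτ0 hτ

theorem exists_weak_limit
    (hC : C ≠ ∞) (hT : ∀ f : Lp 𝕜 2 μ, ∀ τ : ℝ≥0∞, τ ≠ 0 → τ ≠ ∞ →
      τ * μ {x | τ < ‖T f x‖ₑ} ≤ C * ∫⁻ x, ‖f x‖ₑ ∂μ) (f : Lp 𝕜 1 μ) :
    ∃ F : X →ₘ[μ] 𝕜, ∀ (w : Lp 𝕜 1 μ) (v : Lp 𝕜 2 μ), (w : X →ₘ[μ] 𝕜) = (v : X →ₘ[μ] 𝕜) →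
      ∀ τ : ℝ≥0∞, τ ≠ 0 → τ ≠ ∞ → τ * μ {x | τ < ‖F x - T v x‖ₑ} ≤ C * edist f w := by
  choose u v huv hu using fun n : ℕ =>
    exists_Lp_two_edist_lt f (ε := (4⁻¹ : ℝ≥0∞) ^ n) (pow_ne_zero _ (by simp))
  have h42 : ∀ n : ℕ, (4⁻¹ : ℝ≥0∞) ^ n = 2⁻¹ ^ n * 2⁻¹ ^ n := fun n => by
    rw [← mul_pow, ← ENNReal.mul_inv (by simp) (by simp)]
    norm_num
  set A : ℕ → Set X := fun n => {x | (2⁻¹ : ℝ≥0∞) ^ n < ‖T (v n) x - T (v (n + 1)) x‖ₑ} with hA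
  have hμA : ∀ n, μ (A n) ≤ C * 2 * (2⁻¹ : ℝ≥0∞) ^ n := by
    intro n
    have h20 : (2⁻¹ : ℝ≥0∞) ^ n ≠ 0 := pow_ne_zero _ (by simp)
    have h2t : (2⁻¹ : ℝ≥0∞) ^ n ≠ ∞ := ENNReal.pow_ne_top (by simp)
    refine (ENNReal.mul_le_mul_iff_right h20 h2t).1 ?_
    calc (2⁻¹ : ℝ≥0∞) ^ n * μ (A n) ≤ C * edist (u n) (u (n + 1)) :=
          mul_measure_lt_enorm_sub_le hT (huv n) (huv (n + 1)) h20 h2t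
      _ ≤ C * ((4⁻¹ : ℝ≥0∞) ^ n + (4⁻¹ : ℝ≥0∞) ^ n) := by
          gcongr
          refine (edist_triangle_left _ _ f).trans (add_le_add (hu n).le ((hu (n + 1)).le.trans ?_))
          exact pow_le_pow_right_of_le_one' (by simp) n.le_succ
      _ = _ := by
          rw [h42]
          ring
  have hsum : ∑' n, μ (A n) ≠ ∞ := by
    refine ne_top_of_le_ne_top ?_ (ENNReal.tsum_le_tsum hμA)
    rw [ENNReal.tsum_mul_left, ENNReal.tsum_geometric, ENNReal.one_sub_inv_two, inv_inv]
    finiteness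
  have hlim : ∀ᵐ x ∂μ, ∃ l, Tendsto (fun n => T (v n) x) atTop (𝓝 l) := by
    filter_upwards [ae_eventually_notMem hsum] with x hx
    refine cauchySeq_tendsto_of_complete (cauchySeq_of_summable_dist ?_)
    refine Summable.of_norm_bounded_eventually_nat (g := fun n => (1 / 2 : ℝ) ^ n)
      summable_geometric_two ?_
    filter_upwards [hx] with n hn
    have h1 : ‖T (v n) x - T (v (n + 1)) x‖ₑ ≤ (2⁻¹ : ℝ≥0∞) ^ n := by simpa [hA] using hn
    rw [Real.norm_of_nonneg dist_nonneg, dist_eq_norm]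
    have h2 := ENNReal.toReal_mono (ENNReal.pow_ne_top (by simp)) h1
    simpa using h2
  obtain ⟨F, hF, hFlim⟩ := exists_stronglyMeasurable_limit_of_tendsto_ae
    (fun n => AEEqFun.aestronglyMeasurable (T (v n))) hlim
  obtain ⟨F', hF'⟩ : ∃ F' : X →ₘ[μ] 𝕜, F' =ᵐ[μ] F :=
    ⟨AEEqFun.mk F hF.aestronglyMeasurable, AEEqFun.coeFn_mk _ _⟩
  refine ⟨F', fun w v' hwv τ hτ0 hτ => ?_⟩
  set E : ℕ → Set X := fun n => {x | τ < ‖T (v n) x - T v' x‖ₑ} with hE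
  set B : ℕ → Set X := fun N => ⋂ n ≥ N, E n with hB
  have hBmono : Monotone B := fun M N hMN => biInter_mono (fun n hn => hMN.trans hn)
    fun _ _ => Subset.rfl
  have hsub : μ {x | τ < ‖F' x - T v' x‖ₑ} ≤ μ (⋃ N, B N) := by
    refine measure_mono_ae ?_
    filter_upwards [hF', hFlim] with x hx hlx
    intro (hxτ : τ < ‖_‖ₑ)
    change x ∈ ⋃ N, B N
    rw [hx] at hxτ
    have h1 : Tendsto (fun n => ‖T (v n) x - T v' x‖ₑ) atTop (𝓝 ‖F x - T v' x‖ₑ) :=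
      (hlx.sub_const _).enorm
    obtain ⟨N, hN⟩ := eventually_atTop.1 (h1.eventually (lt_mem_nhds hxτ))
    exact mem_iUnion.2 ⟨N, mem_iInter₂.2 fun n hn => hN n hn⟩
  have hlim2 : Tendsto (fun n : ℕ => C * ((4⁻¹ : ℝ≥0∞) ^ n + edist f w)) atTop
      (𝓝 (C * (0 + edist f w))) :=
    ENNReal.Tendsto.const_mul ((ENNReal.tendsto_pow_atTop_nhds_zero_of_lt_one
      (by simp)).add_const _) (Or.inr hC)
  rw [zero_add] at hlim2
  refine (mul_le_mul' le_rfl hsub).trans ?_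
  rw [hBmono.measure_iUnion, ENNReal.mul_iSup]
  refine iSup_le fun N => ge_of_tendsto hlim2 ?_
  filter_upwards [eventually_ge_atTop N] with n hn
  calc τ * μ (B N) ≤ τ * μ (E n) := by
        gcongr
        exact biInter_subset_of_mem hn
    _ ≤ C * edist (u n) w := mul_measure_lt_enorm_sub_le hT (huv n) hwv hτ0 hτ
    _ ≤ C * ((4⁻¹ : ℝ≥0∞) ^ n + edist f w) := by
        gcongr
        refine (edist_triangle_left _ _ f).trans ?_
        gcongr
        exact (hu n).le

theorem isWeakTypeOneOne_of_weak_bound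
    (hC : C ≠ ∞) (hT : ∀ f : Lp 𝕜 2 μ, ∀ τ : ℝ≥0∞, τ ≠ 0 → τ ≠ ∞ →
      τ * μ {x | τ < ‖T f x‖ₑ} ≤ C * ∫⁻ x, ‖f x‖ₑ ∂μ) : IsWeakTypeOneOne T := by
  choose T₁ hT₁ using exists_weak_limit hC hT
  have hlin : ∀ (a : 𝕜) (f g : Lp 𝕜 1 μ), T₁ (a • f + g) = a • T₁ f + T₁ g := by
    intro a f g
    refine AEEqFun.ext ?_
    have key : ∀ᵐ x ∂μ, T₁ (a • f + g) x - (a * T₁ f x + T₁ g x) = 0 := by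
      refine ae_eq_zero_of_forall_mul_measure_le (κ := 2 + ‖a‖ₑ) (L := C * (3 + ‖a‖ₑ))
        (by finiteness) (by finiteness) fun τ η hτ0 hτ hη => ?_
      obtain ⟨w, v, hwv, hw⟩ := exists_Lp_two_edist_lt f hη
      obtain ⟨w', v', hwv', hw'⟩ := exists_Lp_two_edist_lt g hη
      have hm : ((a • w + w' : Lp 𝕜 1 μ) : X →ₘ[μ] 𝕜) = ((a • v + v' : Lp 𝕜 2 μ) : X →ₘ[μ] 𝕜) := by
        change a • (w : X →ₘ[μ] 𝕜) + (w' : X →ₘ[μ] 𝕜) = a • (v : X →ₘ[μ] 𝕜) + (v' : X →ₘ[μ] 𝕜)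
        rw [hwv, hwv']
      have h1 := hT₁ (a • f + g) _ _ hm τ hτ0 hτ
      have h2 := hT₁ f w v hwv τ hτ0 hτ
      have h3 := hT₁ g w' v' hwv' τ hτ0 hτ
      have hed : edist (a • f + g) (a • w + w') ≤ ‖a‖ₑ * η + η := by
        refine (edist_add_add_le _ _ _ _).trans (add_le_add ?_ hw'.le)
        rw [edist_smul₀]
        exact mul_le_mul' le_rfl hw.le
      have hsub : μ {x | (2 + ‖a‖ₑ) * τ < ‖T₁ (a • f + g) x - (a * T₁ f x + T₁ g x)‖ₑ} ≤
          μ ({x | τ < ‖T₁ (a • f + g) x - T (a • v + v') x‖ₑ} ∪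
            ({x | τ < ‖T₁ f x - T v x‖ₑ} ∪ {x | τ < ‖T₁ g x - T v' x‖ₑ})) := by
        refine measure_mono_ae ?_
        rw [map_add, map_smul]
        filter_upwards [AEEqFun.coeFn_add (a • T v) (T v'), AEEqFun.coeFn_smul a (T v)]
          with x hx hx'
        intro (hxτ : (2 + ‖a‖ₑ) * τ < ‖_‖ₑ)
        change x ∈ (_ : Set X)
        by_contra h
        simp only [mem_union, not_or, mem_ofPred_eq, not_lt] at h
        rw [hx, Pi.add_apply, hx', Pi.smul_apply, smul_eq_mul] at h
        obtain ⟨ha, hb, hc⟩ := h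
        have e : T₁ (a • f + g) x - (a * T₁ f x + T₁ g x) =
            (T₁ (a • f + g) x - (a * T v x + T v' x)) - a * (T₁ f x - T v x) -
              (T₁ g x - T v' x) := by ring
        refine absurd hxτ (not_lt.2 ?_)
        rw [e]
        calc _ ≤ τ + ‖a‖ₑ * τ + τ := by
              refine enorm_sub_le.trans (add_le_add (enorm_sub_le.trans (add_le_add ha ?_)) hc)
              rw [enorm_mul]
              gcongr
          _ = _ := by ring
      calc τ * μ {x | (2 + ‖a‖ₑ) * τ < ‖T₁ (a • f + g) x - (a * T₁ f x + T₁ g x)‖ₑ}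
          ≤ τ * (μ {x | τ < ‖T₁ (a • f + g) x - T (a • v + v') x‖ₑ} +
            (μ {x | τ < ‖T₁ f x - T v x‖ₑ} + μ {x | τ < ‖T₁ g x - T v' x‖ₑ})) :=
            mul_le_mul' le_rfl (hsub.trans ((measure_union_le _ _).trans
              (add_le_add le_rfl (measure_union_le _ _))))
        _ = τ * μ {x | τ < ‖T₁ (a • f + g) x - T (a • v + v') x‖ₑ} +
            (τ * μ {x | τ < ‖T₁ f x - T v x‖ₑ} + τ * μ {x | τ < ‖T₁ g x - T v' x‖ₑ}) := by ring
        _ ≤ C * (‖a‖ₑ * η + η) + (C * η + C * η) := by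
            refine add_le_add (h1.trans (mul_le_mul' le_rfl hed)) (add_le_add
              (h2.trans (mul_le_mul' le_rfl hw.le)) (h3.trans (mul_le_mul' le_rfl hw'.le)))
        _ = _ := by ring
    filter_upwards [key, AEEqFun.coeFn_add (a • T₁ f) (T₁ g), AEEqFun.coeFn_smul a (T₁ f)]
      with x hx h1 h2
    rw [h1, Pi.add_apply, h2, Pi.smul_apply, smul_eq_mul]
    exact sub_eq_zero.1 hx
  have hagree : ∀ (f : Lp 𝕜 1 μ) (g : Lp 𝕜 2 μ), (f : X →ₘ[μ] 𝕜) = (g : X →ₘ[μ] 𝕜) →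
      T₁ f = T g := by
    intro f g hfg
    refine AEEqFun.ext ?_
    have key : ∀ᵐ x ∂μ, T₁ f x - T g x = 0 := by
      refine ae_eq_zero_of_forall_mul_measure_le (κ := 1) (L := C) (by finiteness) hC
        fun τ η hτ0 hτ _ => ?_
      have := hT₁ f f g hfg τ hτ0 hτ
      rw [edist_self, mul_zero] at this
      rw [one_mul]
      exact this.trans zero_le
    filter_upwards [key] with x hx
    exact sub_eq_zero.1 hx
  have hzero : T₁ 0 = 0 := by
    rw [hagree 0 0 rfl, map_zero]
  refine ⟨{ toFun := T₁
            map_add' := fun f g => by simpa using hlin 1 f g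
            map_smul' := fun a f => by simpa [hzero] using hlin a f 0 }, hagree,
    C.toReal + 1, by positivity, fun f t ht => ?_⟩
  have h1 := hT₁ f 0 0 rfl (ENNReal.ofReal t) (by simpa using ht) ENNReal.ofReal_ne_top
  have e1 : μ {x | t < ‖T₁ f x‖} ≤ μ {x | ENNReal.ofReal t < ‖T₁ f x - T 0 x‖ₑ} := by
    refine measure_mono_ae ?_
    rw [map_zero]
    filter_upwards [AEEqFun.coeFn_zero (α := X) (β := 𝕜) (μ := μ)] with x hx
    intro (hxt : t < ‖T₁ f x‖)
    change ENNReal.ofReal t < _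
    rw [hx, Pi.zero_apply, sub_zero, ← ofReal_norm]
    exact (ENNReal.ofReal_lt_ofReal_iff (ht.trans hxt)).2 hxt
  rw [edist_zero_right, ← ofReal_norm, ← ENNReal.ofReal_toReal hC,
    ← ENNReal.ofReal_mul ENNReal.toReal_nonneg] at h1
  change μ {x | t < ‖T₁ f x‖} ≤ _
  refine e1.trans ?_
  rw [mul_comm, ← ENNReal.le_div_iff_mul_le (Or.inl (by simpa using ht))
    (Or.inl ENNReal.ofReal_ne_top), ← ENNReal.ofReal_div_of_pos ht] at h1
  refine h1.trans (ENNReal.ofReal_le_ofReal ?_)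
  rw [div_mul_eq_mul_div]
  gcongr
  linarith

end Extension

theorem mainTheorem6 {X 𝕜 : Type*} [MetricSpace X] [MeasurableSpace X] [BorelSpace X] [RCLike 𝕜]
    (hX : GeometricallyDoubling X) (μ : Measure X) (lam : X → ℝ → ℝ)
    (hμ : IsUpperDoubling μ lam) (K : X → X → 𝕜) (T : Lp 𝕜 2 μ →ₗ[𝕜] (X →ₘ[μ] 𝕜))
    (hT : IsCalderonZygmundOperator μ lam K T) (hT2 : IsBoundedOnL2 T) :
    IsWeakTypeOneOne T := by
  have := hX.secondCountableTopology
  obtain ⟨C, hC, hw⟩ := hT.exists_weak_bound hμ hT2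
  exact isWeakTypeOneOne_of_weak_bound hC hw
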